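/- Let $n\ge 5$, let $QD_{2^n}=\langle x,y \mid x^{2^{n-1}}=1,\ y^2=1,\ y^{-1}xy=x^{2^{n-2}-1}\rangle$ be the quasidihedral group, and let $m=2^{n-2}$. A subgroup $G\le \mathrm{GL}_m(\mathbb{Q})$ is called symplectic if there is an invertible skew-symmetric $F\in\mathbb{Q}^{m\times m}$ with $gFg^{\mathrm{tr}}=F$ for all $g\in G$. It is called symplectic irreducible maximal finite (s.i.m.f.) if it is finite, symplectic, acts irreducibly on $\mathbb{Q}^m$, and is not properly contained in any finite symplectic subgroup of $\mathrm{GL}_m(\mathbb{Q})$. Then: 1. Up to equivalence, $QD_{2^n}$ has exactly one irreducible representation $\rho\colon QD_{2^n}\to \mathrm{GL}_m(\mathbb{Q})$ over $\mathbb{Q}$ of degree $m=2^{n-2}$, and it is faithful. 2. Its image $G=\rho(QD_{2^n})$ is s.i.m.f. Moreover, with $J=\begin{pmatrix}0&I\\-I&0\end{pmatrix}$ and $\mathrm{Sp}_m(\mathbb{Q})=\{g\in\mathrm{GL}_m(\mathbb{Q}) \mid gJg^{\mathrm{tr}}=J\}$, the group $G$ is conjugate in $\mathrm{GL}_m(\mathbb{Q})$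 to a subgroup of $\mathrm{Sp}_m(\mathbb{Q})$, and every $\mathrm{GL}_m(\mathbb{Q})$-conjugate of $G$ contained in $\mathrm{Sp}_m(\mathbb{Q})$ is a maximal finite subgroup of $\mathrm{Sp}_m(\mathbb{Q})$. 3. The commuting algebra $\{e\in\mathbb{Q}^{m\times m} \mid eg=ge \text{ for all } g\in G\}$ is isomorphic, as a $\mathbb{Q}$-algebra, to the field $\mathbb{Q}(\zeta-\zeta^{-1})$ for every primitive $2^{n-1}$-th root of unity $\zeta$. -/

import Mathlib

open Matrix

/-- The quasidihedral group
`QD_{2^n} = ⟨x, y ∣ x^{2^{n-1}}, y^2, y⁻¹ x y = x^{2^{n-2}-1}⟩` (for `n ≥ 4`),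
with `x` the generator `0` and `y` the generator `1`. -/
abbrev QuasiDihedral (n : ℕ) : Type :=
  PresentedGroup
    ({FreeGroup.of 0 ^ (2 ^ (n - 1)), FreeGroup.of 1 ^ 2,
      (FreeGroup.of 1)⁻¹ * FreeGroup.of 0 * FreeGroup.of 1 *
        (FreeGroup.of 0 ^ (2 ^ (n - 2) - 1))⁻¹} : Set (FreeGroup (Fin 2)))

section MatrixGroups

variable {ι : Type*} [Fintype ι] [DecidableEq ι]

/-- The rational representation on column vectors given by a homomorphism into `GL_ι(ℚ)`. -/
noncomputable def matrixRep {Γ : Type*} [Group Γ] (ρ : Γ →* GL ι ℚ) :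
    Representation ℚ Γ (ι → ℚ) :=
  ((Matrix.toLinAlgEquiv' : Matrix ι ι ℚ ≃ₐ[ℚ] ((ι → ℚ) →ₗ[ℚ] (ι → ℚ))) :
      Matrix ι ι ℚ →* ((ι → ℚ) →ₗ[ℚ] (ι → ℚ))).comp
    ((Units.coeHom (Matrix ι ι ℚ)).comp ρ)

theorem matrixRep_apply {Γ : Type*} [Group Γ] (ρ : Γ →* GL ι ℚ) (g : Γ) (v : ι → ℚ) :
    matrixRep ρ g v = (ρ g : Matrix ι ι ℚ) *ᵥ v := rfl

/-- A matrix group is rationally irreducible if its natural representation is irreducible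
over `ℚ`. -/
def IsRationallyIrreducible (G : Subgroup (GL ι ℚ)) : Prop :=
  (matrixRep G.subtype).IsIrreducible

/-- A matrix group is symplectic if it preserves some invertible skew-symmetric form. -/
def IsSymplectic (G : Subgroup (GL ι ℚ)) : Prop :=
  ∃ F : Matrix ι ι ℚ, Fᵀ = -F ∧ IsUnit F ∧
    ∀ g ∈ G, (g : Matrix ι ι ℚ) * F * (g : Matrix ι ι ℚ)ᵀ = F

/-- Symplectic irreducible maximal finite (s.i.m.f.) matrix groups: rationally irreducible
groups that are maximal among the finite symplectic subgroups of `GL_ι(ℚ)`. -/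
def IsSIMF (G : Subgroup (GL ι ℚ)) : Prop :=
  IsRationallyIrreducible G ∧
    Maximal (fun H : Subgroup (GL ι ℚ) => Finite H ∧ IsSymplectic H) G

/-- The commuting algebra of a matrix group: all matrices commuting with the group. -/
def commutingAlgebra (G : Subgroup (GL ι ℚ)) : Subalgebra ℚ (Matrix ι ι ℚ) :=
  Subalgebra.centralizer ℚ ((fun g : GL ι ℚ => (g : Matrix ι ι ℚ)) '' (G : Set (GL ι ℚ)))

/-- The conjugate `T G T⁻¹`. -/
def conjSubgroup (T : GL ι ℚ) (G : Subgroup (GL ι ℚ)) : Subgroup (GL ι ℚ) :=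
  G.map (MulAut.conj T).toMonoidHom

end MatrixGroups

/-- `Sp_{2k}(ℚ)` as a subgroup of `GL_{2k}(ℚ)`, the matrices being indexed by two blocks of
size `k`. -/
def Sp (k : ℕ) : Subgroup (GL (Fin k ⊕ Fin k) ℚ) where
  carrier := {g | (g : Matrix (Fin k ⊕ Fin k) (Fin k ⊕ Fin k) ℚ) ∈
    Matrix.symplecticGroup (Fin k) ℚ}
  mul_mem' {a b} ha hb := by
    simpa using (Matrix.symplecticGroup (Fin k) ℚ).mul_mem ha hb
  one_mem' := by
    simp
  inv_mem' {a} ha := by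
    have h : (a : Matrix (Fin k ⊕ Fin k) (Fin k ⊕ Fin k) ℚ) ∈
      Matrix.symplecticGroup (Fin k) ℚ := ha
    have h2 := (((⟨_, h⟩ : Matrix.symplecticGroup (Fin k) ℚ))⁻¹).2
    rw [SymplecticGroup.coe_inv'] at h2
    simpa using h2

/-! ### Galois theory of the 2-power cyclotomic field -/

section CyclotomicTwoPower

variable {e : ℕ} {L : Type*} [Field L] [Algebra ℚ L] [IsCyclotomicExtension {2 ^ (e + 2)} ℚ L]
  {ζ : L}

/-! Put n = e + 3, let ζ be a primitive 2^(e+2)-th root of unity, L = ℚ(ζ), of degree 2^(e+1) = m, σ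
the automorphism ζ ↦ -ζ⁻¹, and π = ζ - ζ⁻¹. The model representation is L itself, with x acting as
multiplication by ζ and y as σ. Conversely, irreducibility in degree m forces X^(2^(e+1)) = -1
(`map_x_pow_eq_neg_one`), so ℚ[X] is a copy of L acting on a one-dimensional L-space, and a vector
fixed by Y identifies that space with the model (`exists_model_of_isIrreducible`). Uniqueness and
faithfulness follow, and the commuting algebra is the fixed field of σ, which is ℚ(π).

Maximality. Let H be a finite symplectic overgroup of the image G, with invariant forms S symmetric
and F skew. Then F S⁻¹ commutes with H, hence is some c in L with σ c = c, and skewness makes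
complex conjugation send c to -c. Galois theory gives π ∈ ℚ(c), so π commutes with all of H
(`commute_sub_inv_of_isSymplectic`).

Therefore N = {h ∈ H : h ≡ 1 mod π} is normal in H. Since π divides 2 and a power of π is divisible
by 2, N is a 2-group (`isPGroup_congruenceSubgroup`). It contains x² = 1 + π x. An element h of H
conjugating x² into G already lies in G (`exists_eq_pow_or_of_conj_sq`): it sends ζ to a root of the
quadratic of ζ over ℚ(π), so h or Y h centralizes L and is a root of unity.

Hence G is its own normalizer in the 2-group G N, so N ≤ G; as N is normal, every h in H conjugates
x² into G, and H = G (`eq_top_of_isPGroup_of_forall_conj`). Statements about `Sp` follow by bringing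
F to the standard form. -/

theorem IsPrimitiveRoot.pow_two_pow_eq_neg_one {L : Type*} [Field L] {e : ℕ} {ζ : L}
    (hζ : IsPrimitiveRoot ζ (2 ^ (e + 2))) :
    ζ ^ 2 ^ (e + 1) = -1 :=
  (hζ.pow (by positivity) (pow_succ 2 (e + 1))).eq_neg_one_of_two_right

theorem IsPrimitiveRoot.sq_ne_neg_one {L : Type*} [Field L] {e : ℕ} {ζ : L}
    (hζ : IsPrimitiveRoot ζ (2 ^ (e + 2))) (he : 1 ≤ e) : ζ ^ 2 ≠ -1 := by
  intro h
  have h4 : ζ ^ 4 = 1 := by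
    rw [show 4 = 2 * 2 from rfl, pow_mul, h]; norm_num
  have := Nat.le_of_dvd (by norm_num) ((hζ.pow_eq_one_iff_dvd 4).1 h4)
  have h8 : 2 ^ 3 ≤ 2 ^ (e + 2) := Nat.pow_le_pow_right (by norm_num) (by omega)
  omega

include e in
theorem finrank_cyclotomic_two_pow : Module.finrank ℚ L = 2 ^ (e + 1) := by
  rw [IsCyclotomicExtension.finrank (n := 2 ^ (e + 2)) L
    (Polynomial.cyclotomic.irreducible_rat (by positivity)),
    Nat.totient_prime_pow_succ Nat.prime_two]
  simp

theorem IsPrimitiveRoot.cyclotomic_induction (hζ : IsPrimitiveRoot ζ (2 ^ (e + 2)))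
    {p : L → Prop} (alg : ∀ q : ℚ, p (algebraMap ℚ L q)) (gen : p ζ)
    (add : ∀ a b, p a → p b → p (a + b)) (mul : ∀ a b, p a → p b → p (a * b)) (a : L) : p a := by
  have ha : a ∈ Algebra.adjoin ℚ {ζ} := by
    rw [IsCyclotomicExtension.adjoin_primitive_root_eq_top hζ]; trivial
  induction ha using Algebra.adjoin_induction with
  | mem x hx => rw [Set.mem_singleton_iff] at hx; rwa [hx]
  | algebraMap q => exact alg q
  | add x y _ _ hx hy => exact add x y hx hy
  | mul x y _ _ hx hy => exact mul x y hx hy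

/-- The minimal polynomial of ζ is the cyclotomic polynomial T^(2^(e+1)) + 1, so the relation on x
is the only obstruction. The target may be noncommutative; it will be a matrix algebra. -/
theorem IsPrimitiveRoot.exists_algHom (hζ : IsPrimitiveRoot ζ (2 ^ (e + 2)))
    {A : Type*} [Ring A] [Algebra ℚ A] {x : A} (hx : x ^ 2 ^ (e + 1) = -1) :
    ∃ θ : L →ₐ[ℚ] A, θ ζ = x := by
  have hgen := hζ.powerBasis_gen ℚ
  generalize hζ.powerBasis ℚ = pb at hgen
  subst hgen
  refine ⟨pb.lift x ?_, pb.lift_gen x _⟩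
  rw [← hζ.minpoly_eq_cyclotomic_of_irreducible (K := ℚ)
    (Polynomial.cyclotomic.irreducible_rat (by positivity)),
    Polynomial.cyclotomic_prime_pow_eq_geom_sum Nat.prime_two, Finset.sum_range_succ,
    Finset.sum_range_one]
  simp [hx]

theorem IsPrimitiveRoot.exists_algEquiv (hζ : IsPrimitiveRoot ζ (2 ^ (e + 2))) {d : L}
    (hd : d ^ 2 ^ (e + 1) = -1) : ∃ τ : L ≃ₐ[ℚ] L, τ ζ = d := by
  obtain ⟨θ, hθ⟩ := hζ.exists_algHom hd
  have : FiniteDimensional ℚ L := IsCyclotomicExtension.finiteDimensional {2 ^ (e + 2)} ℚ L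
  exact ⟨AlgEquiv.ofBijective θ (Algebra.IsAlgebraic.algHom_bijective θ), hθ⟩

theorem IsPrimitiveRoot.exists_algEquiv_neg_inv (hζ : IsPrimitiveRoot ζ (2 ^ (e + 2))) :
    ∃ σ : L ≃ₐ[ℚ] L, σ ζ = -ζ⁻¹ := by
  apply hζ.exists_algEquiv
  rw [(Nat.even_pow.2 ⟨even_two, by omega⟩).neg_pow, inv_pow, hζ.pow_two_pow_eq_neg_one]
  norm_num

theorem IsPrimitiveRoot.exists_algEquiv_inv (hζ : IsPrimitiveRoot ζ (2 ^ (e + 2))) :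
    ∃ σ : L ≃ₐ[ℚ] L, σ ζ = ζ⁻¹ := by
  apply hζ.exists_algEquiv
  rw [inv_pow, hζ.pow_two_pow_eq_neg_one]
  norm_num

theorem IsPrimitiveRoot.algEquiv_ext (hζ : IsPrimitiveRoot ζ (2 ^ (e + 2))) {σ τ : L ≃ₐ[ℚ] L}
    (h : σ ζ = τ ζ) : σ = τ := by
  ext a
  induction a using hζ.cyclotomic_induction with
  | alg q => simp
  | gen => exact h
  | add a b ha hb => simp [ha, hb]
  | mul a b ha hb => simp [ha, hb]

omit [IsCyclotomicExtension {2 ^ (e + 2)} ℚ L] in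
theorem IsPrimitiveRoot.exists_odd_pow (hζ : IsPrimitiveRoot ζ (2 ^ (e + 2))) (τ : L ≃ₐ[ℚ] L) :
    ∃ s, Odd s ∧ τ ζ = ζ ^ s := by
  obtain ⟨s, -, hs⟩ := hζ.eq_pow_of_pow_eq_one (ξ := τ ζ) (by rw [← map_pow, hζ.pow_eq_one, map_one])
  refine ⟨s, ?_, hs.symm⟩
  by_contra hodd
  rw [Nat.not_odd_iff_even] at hodd
  have h1 : (τ ζ) ^ 2 ^ (e + 1) = -1 := by
    rw [← map_pow, hζ.pow_two_pow_eq_neg_one, map_neg, map_one]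
  have : CharZero L := algebraRat.charZero L
  rw [← hs, ← pow_mul, mul_comm, pow_mul, hζ.pow_two_pow_eq_neg_one, hodd.neg_one_pow] at h1
  norm_num at h1

theorem IsPrimitiveRoot.isGalois_rat (_ : IsPrimitiveRoot ζ (2 ^ (e + 2))) : IsGalois ℚ L :=
  IsCyclotomicExtension.isGalois {2 ^ (e + 2)} ℚ L

theorem mem_adjoin_of_forall_algEquiv {K L : Type*} [Field K] [Field L] [Algebra K L]
    [FiniteDimensional K L] [IsGalois K L] {a b : L} (h : ∀ τ : L ≃ₐ[K] L, τ b = b → τ a = a) :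
    a ∈ IntermediateField.adjoin K {b} := by
  rw [← IsGalois.fixedField_fixingSubgroup (IntermediateField.adjoin K {b}),
    IntermediateField.mem_fixedField_iff]
  intro τ hτ
  rw [IntermediateField.mem_fixingSubgroup_iff] at hτ
  exact h τ (hτ b (IntermediateField.mem_adjoin_simple_self K b))

/-- The quadratic is (T - ζ)(T + ζ⁻¹), whose coefficients lie in ℚ(ζ - ζ⁻¹). -/
theorem IsPrimitiveRoot.eq_or_eq_of_sub_inv {L : Type*} [Field L] {ζ : L} {N : ℕ} [NeZero N]
    (hζ : IsPrimitiveRoot ζ N) {d : L}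
    (hd : d * d - (ζ - ζ⁻¹) * d - 1 = 0) : d = ζ ∨ d = -ζ⁻¹ := by
  have hζ0 : ζ ≠ 0 := hζ.ne_zero (NeZero.ne N)
  have : (d - ζ) * (d + ζ⁻¹) = 0 := by
    rw [← hd]; field_simp; ring
  rcases mul_eq_zero.1 this with h | h
  · exact Or.inl (sub_eq_zero.1 h)
  · exact Or.inr (eq_neg_of_add_eq_zero_left h)

/-- An automorphism fixing ζ - ζ⁻¹ sends ζ to a root of its quadratic, so it is 1 or σ. -/
theorem IsPrimitiveRoot.mem_adjoin_sub_inv_iff (hζ : IsPrimitiveRoot ζ (2 ^ (e + 2)))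
    {σ : L ≃ₐ[ℚ] L} (hσ : σ ζ = -ζ⁻¹) {c : L} :
    c ∈ IntermediateField.adjoin ℚ {ζ - ζ⁻¹} ↔ σ c = c := by
  have : FiniteDimensional ℚ L := IsCyclotomicExtension.finiteDimensional {2 ^ (e + 2)} ℚ L
  have := hζ.isGalois_rat
  constructor
  · intro hc
    have hle : IntermediateField.adjoin ℚ {ζ - ζ⁻¹} ≤
        IntermediateField.fixedField (Subgroup.zpowers σ) := by
      rw [IntermediateField.adjoin_simple_le_iff, IntermediateField.mem_fixedField_iff]
      intro τ hτ
      have hfix : σ (ζ - ζ⁻¹) = ζ - ζ⁻¹ := by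
        rw [map_sub, map_inv₀, hσ, inv_neg, inv_inv]; ring
      have hle : Subgroup.zpowers σ ≤ MulAction.stabilizer (L ≃ₐ[ℚ] L) (ζ - ζ⁻¹) := by
        rw [Subgroup.zpowers_le]; exact hfix
      exact hle hτ
    exact (IntermediateField.mem_fixedField_iff _ _).1 (hle hc) σ (Subgroup.mem_zpowers σ)
  · intro hc
    refine mem_adjoin_of_forall_algEquiv fun τ hτ => ?_
    have hζ0 : ζ ≠ 0 := hζ.ne_zero (by positivity)
    rcases hζ.eq_or_eq_of_sub_inv (d := τ ζ) (by
      have h0 : τ ζ ≠ 0 := by simpa using hζ0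
      rw [← hτ, map_sub, map_inv₀]; field_simp; ring) with h | h
    · rw [hζ.algEquiv_ext (σ := τ) (τ := AlgEquiv.refl) h]; rfl
    · rw [hζ.algEquiv_ext (σ := τ) (τ := σ) (h.trans hσ.symm), hc]

/-- Among automorphisms ζ ↦ ζ^(4t+1) the only involution is ζ ↦ -ζ, which moves c. Descending
through squares, an element of 2-power order fixing c must be trivial. -/
theorem IsPrimitiveRoot.algEquiv_eq_one_of_fixes (hζ : IsPrimitiveRoot ζ (2 ^ (e + 2)))
    {c : L} (hneg : ∀ μ : L ≃ₐ[ℚ] L, μ ζ = -ζ → μ c ≠ c) (r : ℕ) :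
    ∀ τ : L ≃ₐ[ℚ] L, τ c = c → (∃ t, τ ζ = ζ ^ (4 * t + 1)) → τ ^ 2 ^ r = 1 → τ = 1 := by
  induction r with
  | zero => intro τ _ _ h; simpa using h
  | succ r ih =>
    rintro τ hc ⟨t, ht⟩ h
    have h2 : τ ^ 2 = 1 := by
      refine ih _ ?_ ⟨4 * t ^ 2 + 2 * t, ?_⟩ ?_
      · rw [pow_two, AlgEquiv.mul_apply, hc, hc]
      · rw [pow_two, AlgEquiv.mul_apply, ht, map_pow, ht, ← pow_mul]
        congr 1; ring
      · rw [← pow_mul, ← pow_succ', h]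
    have h3 : ζ ^ ((4 * t + 1) * (4 * t + 1)) = ζ := by
      have := DFunLike.congr_fun h2 ζ
      rwa [pow_two, AlgEquiv.mul_apply, ht, map_pow, ht, ← pow_mul] at this
    have hζ0 : ζ ≠ 0 := hζ.ne_zero (by positivity)
    -- (4t+1)² - 1 = 8t(2t+1) with 2t+1 odd, so 2^(e+2) divides 8t and ζ^(4t) = ±1.
    have h4 : ζ ^ ((8 * t) * (2 * t + 1)) = 1 := by
      apply mul_right_cancel₀ hζ0
      rw [one_mul, ← pow_succ]
      rw [← h3]
      conv_rhs => rw [h3]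
      conv_rhs => rw [← h3]
      congr 1; ring
    have h5 : 2 ^ (e + 2) ∣ 8 * t :=
      Nat.Coprime.dvd_of_dvd_mul_right
        (Nat.Coprime.pow_left _ (by simp)) ((hζ.pow_eq_one_iff_dvd _).1 h4)
    have h6 : (ζ ^ (4 * t)) ^ 2 = 1 := by
      rw [← pow_mul, show 4 * t * 2 = 8 * t by ring]
      exact (hζ.pow_eq_one_iff_dvd _).2 h5
    rcases mul_self_eq_one_iff.1 ((pow_two _).symm.trans h6) with h7 | h7
    · apply hζ.algEquiv_ext
      rw [ht, pow_succ, h7, one_mul]; rfl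
    · exact absurd hc (hneg τ (by rw [ht, pow_succ, h7, neg_one_mul]))

/-- The map ζ ↦ -ζ is κσ and negates c. If τ fixes c, then τ or στ has exponent 1 mod 4, hence is
trivial; either way τ fixes ζ - ζ⁻¹. -/
theorem IsPrimitiveRoot.sub_inv_mem_adjoin (hζ : IsPrimitiveRoot ζ (2 ^ (e + 2))) (he : 1 ≤ e)
    {σ κ : L ≃ₐ[ℚ] L} (hσ : σ ζ = -ζ⁻¹) (hκ : κ ζ = ζ⁻¹) {c : L} (hc0 : c ≠ 0)
    (hσc : σ c = c) (hκc : κ c = -c) :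
    ζ - ζ⁻¹ ∈ IntermediateField.adjoin ℚ {c} := by
  have : FiniteDimensional ℚ L := IsCyclotomicExtension.finiteDimensional {2 ^ (e + 2)} ℚ L
  have := hζ.isGalois_rat
  have : CharZero L := algebraRat.charZero L
  have hζ0 : ζ ≠ 0 := hζ.ne_zero (by positivity)
  have hneg : ∀ μ : L ≃ₐ[ℚ] L, μ ζ = -ζ → μ c ≠ c := by
    intro μ hμ h
    have : μ = κ * σ := hζ.algEquiv_ext (by
      rw [hμ, AlgEquiv.mul_apply, hσ, map_neg, map_inv₀, hκ, inv_inv])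
    rw [this, AlgEquiv.mul_apply, hσc, hκc] at h
    exact hc0 (self_eq_neg.1 h.symm)
  have hone : ∀ τ : L ≃ₐ[ℚ] L, τ c = c → (∃ t, τ ζ = ζ ^ (4 * t + 1)) → τ = 1 := by
    intro τ h1 h2
    refine hζ.algEquiv_eq_one_of_fixes hneg (e + 1) τ h1 h2 ?_
    rw [← finrank_cyclotomic_two_pow (e := e) (L := L), ← IsGalois.card_aut_eq_finrank]
    exact pow_card_eq_one'
  refine mem_adjoin_of_forall_algEquiv fun τ hτ => ?_
  obtain ⟨s, ⟨k, rfl⟩, hs⟩ := hζ.exists_odd_pow τ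
  have hfix : σ (ζ - ζ⁻¹) = ζ - ζ⁻¹ := by
    rw [map_sub, map_inv₀, hσ, inv_neg, inv_inv]; ring
  rcases Nat.even_or_odd k with ⟨t, rfl⟩ | ⟨t, rfl⟩
  · rw [hone τ hτ ⟨t, by rw [hs]; congr 1; ring⟩]; rfl
  · have key : σ * τ = 1 := by
      refine hone _ (by rw [AlgEquiv.mul_apply, hτ, hσc]) ?_
      obtain ⟨s, ⟨k, rfl⟩, hs'⟩ := hζ.exists_odd_pow (σ * τ)
      rcases Nat.even_or_odd k with ⟨u, rfl⟩ | ⟨u, rfl⟩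
      · exact ⟨u, by rw [hs']; congr 1; ring⟩
      · exfalso
        rw [AlgEquiv.mul_apply, hs, map_pow, hσ, (Odd.neg_pow ⟨2 * t + 1, rfl⟩), inv_pow] at hs'
        -- If τ and στ both had exponent 3 mod 4, this would follow; its 2^e-th power reads -1 = 1,
        -- as e ≥ 1.
        have h1 : ζ ^ (4 * (u + t + 1) + 2) = -1 := by
          have h2 := congrArg (· * ζ ^ (2 * (2 * t + 1) + 1)) hs'
          simp only [neg_mul, inv_mul_cancel₀ (pow_ne_zero _ hζ0), ← pow_add] at h2
          rw [h2]; congr 1; ring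
        have h2 := congrArg (· ^ 2 ^ e) h1
        simp only [← pow_mul] at h2
        rw [(Nat.even_pow.2 ⟨even_two, by omega⟩).neg_one_pow,
          show (4 * (u + t + 1) + 2) * 2 ^ e = 2 ^ (e + 2) * (u + t + 1) + 2 ^ (e + 1) by ring,
          pow_add, pow_mul, hζ.pow_eq_one, one_pow, one_mul, hζ.pow_two_pow_eq_neg_one] at h2
        norm_num at h2
    apply σ.injective
    rw [← AlgEquiv.mul_apply, key, hfix]; rfl

theorem IsPrimitiveRoot.exists_pow_eq_of_isOfFinOrder (hζ : IsPrimitiveRoot ζ (2 ^ (e + 2)))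
    {d : L} (hd : IsOfFinOrder d) : ∃ k, d = ζ ^ k := by
  have : CharZero L := algebraRat.charZero L
  have : NumberField L := IsCyclotomicExtension.numberField {2 ^ (e + 2)} ℚ L
  have : @IsCyclotomicExtension {2 ^ (e + 2)} ℚ L _ _ DivisionRing.toRatAlgebra := by
    convert! ‹IsCyclotomicExtension {2 ^ (e + 2)} ℚ L›
    exact Subsingleton.elim _ _
  have hprim := IsPrimitiveRoot.orderOf d
  have hpos := hd.orderOf_pos
  have hdvd := hprim.dvd_of_isCyclotomicExtension (2 ^ (e + 2)) hpos.ne'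
  rw [← pow_succ', Nat.dvd_prime_pow Nat.prime_two] at hdvd
  obtain ⟨j, hj, hj'⟩ := hdvd
  rw [hj'] at hprim
  -- Divisibility still allows order 2^(e+3), but φ(2^(e+3)) = 2^(e+2) exceeds the degree of L.
  have hlt : j ≠ e + 3 := by
    rintro rfl
    have key := IsPrimitiveRoot.lcm_totient_le_finrank hprim hprim
      (Polynomial.cyclotomic.irreducible_rat (Nat.lcm_pos (by positivity) (by positivity)))
    rw [finrank_cyclotomic_two_pow (e := e), Nat.lcm_self, Nat.totient_prime_pow_succ Nat.prime_two,
      pow_succ 2 (e + 1)] at key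
    have := Nat.two_pow_pos (e + 1)
    omega
  obtain ⟨k, -, hk⟩ := hζ.eq_pow_of_pow_eq_one (ξ := d)
    ((hprim.pow_eq_one_iff_dvd _).2 (pow_dvd_pow 2 (by omega)))
  exact ⟨k, hk.symm⟩

end CyclotomicTwoPower

/-! ### A field acting on a rational space of its own degree -/

section CyclotomicMatrixModel

variable {e : ℕ} {L : Type*} [Field L] [Algebra ℚ L]
  {ζ : L} {ι : Type*} [Fintype ι] [DecidableEq ι] {σ : L ≃ₐ[ℚ] L}

theorem mul_algHom_eq_algHom_mul [IsCyclotomicExtension {2 ^ (e + 2)} ℚ L]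
    (hζ : IsPrimitiveRoot ζ (2 ^ (e + 2))) {A : Type*} [Ring A] [Algebra ℚ A]
    (θ : L →ₐ[ℚ] A) (τ : L ≃ₐ[ℚ] L) {Y : A} (h : Y * θ ζ = θ (τ ζ) * Y) (a : L) :
    Y * θ a = θ (τ a) * Y := by
  induction a using hζ.cyclotomic_induction with
  | alg q => rw [AlgEquiv.commutes, AlgHom.commutes, Algebra.commutes]
  | gen => exact h
  | add a b ha hb => simp [mul_add, add_mul, ha, hb]
  | mul a b ha hb => rw [map_mul, map_mul, map_mul, ← mul_assoc, ha, mul_assoc, hb, mul_assoc]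

theorem isUnit_algHom {A : Type*} [Ring A] [Algebra ℚ A] (θ : L →ₐ[ℚ] A) {a : L} (ha : a ≠ 0) :
    IsUnit (θ a) :=
  (IsUnit.mk0 a ha).map θ

theorem algHom_mulVec_bijective (θ : L →ₐ[ℚ] Matrix ι ι ℚ)
    (hdim : Module.finrank ℚ L = Fintype.card ι) {v : ι → ℚ} (hv : v ≠ 0) :
    Function.Bijective fun a => θ a *ᵥ v := by
  have hpos : 0 < Fintype.card ι := by
    obtain ⟨i, -⟩ := Function.ne_iff.1 hv
    exact Fintype.card_pos_iff.2 ⟨i⟩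
  have : FiniteDimensional ℚ L := Module.finite_of_finrank_pos (hdim ▸ hpos)
  let f : L →ₗ[ℚ] (ι → ℚ) :=
    { toFun := fun a => θ a *ᵥ v
      map_add' := fun a b => by simp [add_mulVec]
      map_smul' := fun q a => by simp [smul_mulVec] }
  have hinj : Function.Injective f := by
    rw [injective_iff_map_eq_zero]
    intro a ha
    by_contra h0
    apply hv
    have ha' : θ a *ᵥ v = 0 := ha
    have : θ a⁻¹ *ᵥ (θ a *ᵥ v) = v := by
      rw [mulVec_mulVec, ← map_mul, inv_mul_cancel₀ h0, map_one, one_mulVec]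
    rw [← this, ha', mulVec_zero]
  exact ⟨hinj, (LinearMap.injective_iff_surjective_of_finrank_eq_finrank
    (by rw [hdim, Module.finrank_fintype_fun_eq_card])).1 hinj⟩

/-- The identification of a field with the space on which it acts, for a rational representation
of the same degree. -/
noncomputable def algHomMulVecEquiv (θ : L →ₐ[ℚ] Matrix ι ι ℚ)
    (hdim : Module.finrank ℚ L = Fintype.card ι) {v : ι → ℚ} (hv : v ≠ 0) : L ≃ₗ[ℚ] (ι → ℚ) :=
  LinearEquiv.ofBijective
    { toFun := fun a => θ a *ᵥ v
      map_add' := fun a b => by simp [add_mulVec]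
      map_smul' := fun q a => by simp [smul_mulVec] } (algHom_mulVec_bijective θ hdim hv)

theorem algHomMulVecEquiv_apply (θ : L →ₐ[ℚ] Matrix ι ι ℚ)
    (hdim : Module.finrank ℚ L = Fintype.card ι) {v : ι → ℚ} (hv : v ≠ 0) (a : L) :
    algHomMulVecEquiv θ hdim hv a = θ a *ᵥ v := rfl

/-- The space is one-dimensional over L, so an L-linear map is multiplication by the scalar read off
at v. -/
theorem exists_algHom_eq_of_commute (θ : L →ₐ[ℚ] Matrix ι ι ℚ)
    (hdim : Module.finrank ℚ L = Fintype.card ι) {v : ι → ℚ} (hv : v ≠ 0) {M : Matrix ι ι ℚ}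
    (hM : ∀ a, M * θ a = θ a * M) : ∃ c, M = θ c := by
  have hbij := algHom_mulVec_bijective θ hdim hv
  obtain ⟨c, hc⟩ := hbij.2 (M *ᵥ v)
  refine ⟨c, Matrix.ext_of_mulVec_single fun i => ?_⟩
  obtain ⟨a, ha⟩ := hbij.2 (Pi.single i 1)
  rw [← ha]
  simp only [mulVec_mulVec] at hc ⊢
  rw [hM, ← map_mul, mul_comm, map_mul, ← mulVec_mulVec, ← mulVec_mulVec, hc]

theorem exists_fixed_algHom_eq_of_commute (θ : L →ₐ[ℚ] Matrix ι ι ℚ)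
    (hdim : Module.finrank ℚ L = Fintype.card ι) {Y : Matrix ι ι ℚ}
    (hY : ∀ a, Y * θ a = θ (σ a) * Y) {v : ι → ℚ} (hv : v ≠ 0) (hYv : Y *ᵥ v = v)
    {M : Matrix ι ι ℚ} (hM : ∀ a, M * θ a = θ a * M) (hMY : M * Y = Y * M) :
    ∃ c, M = θ c ∧ σ c = c := by
  obtain ⟨c, rfl⟩ := exists_algHom_eq_of_commute θ hdim hv hM
  refine ⟨c, rfl, (algHom_mulVec_bijective θ hdim hv).1 ?_⟩
  have : (θ (σ c) * Y) *ᵥ v = (θ c * Y) *ᵥ v := by rw [← hY, hMY]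
  simpa only [← mulVec_mulVec, hYv] using this

theorem exists_mulVec_eq_self [Nonempty ι] {Y : Matrix ι ι ℚ} (hY : Y * Y = 1) (hY1 : Y ≠ -1) :
    ∃ v, v ≠ 0 ∧ Y *ᵥ v = v := by
  by_contra! h
  apply hY1
  refine Matrix.ext_of_mulVec_single fun i => ?_
  have key : Y *ᵥ (Pi.single i 1 + Y *ᵥ Pi.single i 1) = Pi.single i 1 + Y *ᵥ Pi.single i 1 := by
    rw [mulVec_add, mulVec_mulVec, hY, one_mulVec, add_comm]
  have h0 : (Pi.single i 1 + Y *ᵥ Pi.single i 1 : ι → ℚ) = 0 := by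
    by_contra h0
    exact h _ h0 key
  rw [neg_mulVec, one_mulVec]
  exact eq_neg_of_add_eq_zero_right h0

end CyclotomicMatrixModel

/-! ### Elements of odd order congruent to 1 -/

section CongruenceKernel

theorem exists_one_add_pow_eq {R : Type*} [Ring R] (z : R) (q : ℕ) :
    ∃ s : R, (1 + z) ^ q = 1 + q * z + z * z * s := by
  induction q with
  | zero => exact ⟨0, by simp⟩
  | succ q ih =>
    obtain ⟨s, hs⟩ := ih
    refine ⟨q + s + s * z, ?_⟩
    have hc : (q : R) * z = z * q := (Nat.cast_commute q z).eq
    rw [pow_succ, hs]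
    push_cast
    have : z * z * (q : R) = q * z * z := by rw [mul_assoc, ← hc, ← mul_assoc, hc]
    rw [mul_add (z * z), mul_add (z * z), this]
    noncomm_ring

/-- In a ring with a central element `p` dividing `2` and all of whose powers are sufficiently
divisible by `2`, there is no element of odd order congruent to `1` modulo `p`. -/
theorem eq_one_of_odd_pow_eq_one {R : Type*} [Ring R] {p : R} (hp : ∀ r, p * r = r * p)
    (hreg : ∀ r, p * r = 0 → r = 0) (h2 : ∃ r, 2 = p * r) {K : ℕ} (hK : ∃ r, p ^ K = 2 * r)
    (hsep : ∀ r : R, (∀ k : ℕ, ∃ s, r = 2 ^ k * s) → r = 0) {g : R} (hg : ∃ r, g = 1 + p * r)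
    {q : ℕ} (hq : Odd q) (hgq : g ^ q = 1) : g = 1 := by
  have hpc : ∀ (k : ℕ) (r : R), p ^ k * r = r * p ^ k := fun k r =>
    ((show Commute p r from hp r).pow_left k).eq
  have hregk : ∀ (k : ℕ) (r : R), p ^ k * r = 0 → r = 0 := by
    intro k
    induction k with
    | zero => intro r h; simpa using h
    | succ k ih =>
      intro r h
      rw [pow_succ, mul_assoc] at h
      exact hreg _ (ih _ h)
  obtain ⟨r₂, hr₂⟩ := h2
  have step : ∀ k : ℕ, ∃ r, g = 1 + p ^ (k + 1) * r := by
    intro k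
    induction k with
    | zero => simpa using hg
    | succ k ih =>
      obtain ⟨r, rfl⟩ := ih
      obtain ⟨s, hs⟩ := exists_one_add_pow_eq (p ^ (k + 1) * r) q
      obtain ⟨j, rfl⟩ := hq
      -- With q = 2j+1, expanding g^q = 1 and cancelling p^(k+1) gives (2j+1) r + p^(k+1) r² s = 0;
      -- substituting 2 = p r₂ exhibits r as p times this witness.
      refine ⟨-(r₂ * j * r) - p ^ k * (r * r * s), ?_⟩
      rw [hgq] at hs
      have h1 : p ^ (k + 1) * ((2 * j + 1 : ℕ) * r + p ^ (k + 1) * (r * r * s)) = 0 := by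
        have e1 : p ^ (k + 1) * ((2 * j + 1 : ℕ) * r) = (2 * j + 1 : ℕ) * (p ^ (k + 1) * r) := by
          rw [← mul_assoc, ← mul_assoc, hpc]
        have e2 : p ^ (k + 1) * (p ^ (k + 1) * (r * r * s)) =
            p ^ (k + 1) * r * (p ^ (k + 1) * r) * s := by
          have := hpc (k + 1) r
          simp only [← mul_assoc]
          rw [mul_assoc (p ^ (k + 1)) r (p ^ (k + 1)), ← this]
          simp only [mul_assoc]
        rw [mul_add, e1, e2]
        rw [add_assoc] at hs
        exact (add_eq_left.1 hs.symm)
      have h3 := hregk _ _ h1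
      have h4 : r = -(p * (r₂ * j * r)) - p ^ (k + 1) * (r * r * s) := by
        rw [show p * (r₂ * j * r) = 2 * j * r by rw [hr₂]; simp only [mul_assoc]]
        push_cast at h3
        rw [eq_sub_iff_add_eq, eq_neg_iff_add_eq_zero, ← h3]
        noncomm_ring
      have h5 : r = p * (-(r₂ * j * r) - p ^ k * (r * r * s)) := by
        rw [mul_sub, mul_neg, ← mul_assoc p (p ^ k), ← pow_succ']; exact h4
      rw [pow_succ p (k + 1), mul_assoc, ← h5]
  obtain ⟨r₁, hr₁⟩ := hK
  rw [← sub_eq_zero]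
  refine hsep _ fun k => ?_
  obtain ⟨r, hr⟩ := step (K * k)
  refine ⟨r₁ ^ k * (p * r), ?_⟩
  rw [hr, add_sub_cancel_left, pow_succ, pow_mul, hr₁, (Commute.ofNat_left 2 r₁).mul_pow]
  simp only [mul_assoc]

/-- Krull's intersection theorem for the ideal (2) of ℤ. -/
theorem eq_zero_of_forall_two_pow_dvd {A : Type*} [Ring A] [Module.Finite ℤ A]
    [Module.IsTorsionFree ℤ A] (r : A) (h : ∀ k : ℕ, ∃ s, r = 2 ^ k * s) : r = 0 := by
  have hI : Ideal.span {(2 : ℤ)} ≠ ⊤ := by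
    rw [Ne, Ideal.span_singleton_eq_top, Int.isUnit_iff]; omega
  have := Ideal.iInf_pow_smul_eq_bot_of_isTorsionFree (M := A) _ hI
  rw [← Submodule.mem_bot ℤ, ← this, Submodule.mem_iInf]
  intro k
  obtain ⟨s, rfl⟩ := h k
  have : (2 : A) ^ k * s = (2 ^ k : ℤ) • s := by simp [zsmul_eq_mul]
  rw [this]
  exact Submodule.smul_mem_smul
    (Ideal.pow_mem_pow (Ideal.mem_span_singleton_self 2) k) Submodule.mem_top

/-- The instance of `eq_one_of_odd_pow_eq_one` for the element `x - x⁻¹`, where `x` is a root of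
unity of order `2 ^ (e + 2)`. -/
theorem eq_one_of_odd_pow_eq_one_of_sub_inv {R : Type*} [Ring R] [Module.Finite ℤ R]
    [Module.IsTorsionFree ℤ R] {e : ℕ} (he : 1 ≤ e) {x y : R} (hxy : x * y = 1) (hyx : y * x = 1)
    (hx : x ^ 2 ^ (e + 1) = -1) (hp : ∀ r, (x - y) * r = r * (x - y)) {g : R}
    (hg : ∃ r, g = 1 + (x - y) * r) {q : ℕ} (hq : Odd q) (hgq : g ^ q = 1) : g = 1 := by
  have hxp : x ^ 2 - 1 = (x - y) * x := by rw [sub_mul, hyx, pow_two]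
  have hmul : x ^ 2 ^ (e + 1) = (x ^ 2) ^ 2 ^ e := by rw [← pow_mul, ← pow_succ']
  -- -2 = (x²)^(2^e) - 1 is a multiple of x² - 1 = (x - y) x.
  have h2 : ∃ r, 2 = (x - y) * r := by
    refine ⟨-(x * ∑ i ∈ Finset.range (2 ^ e), (x ^ 2) ^ i), ?_⟩
    rw [mul_neg, ← mul_assoc, ← hxp, mul_geom_sum, ← hmul, hx]
    norm_num
  have hreg : ∀ r, (x - y) * r = 0 → r = 0 := by
    intro r hr
    obtain ⟨s, hs⟩ := h2
    have : (2 : ℤ) • r = 0 := by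
      rw [zsmul_eq_mul, Int.cast_ofNat, hs, hp, mul_assoc, hr, mul_zero]
    exact (smul_eq_zero.1 this).resolve_left (by norm_num)
  -- Modulo 2, (x² - 1)^(2^e) is x^(2^(e+1)) + 1 = 0; the unit x^(2^e) is then removed by y^(2^e).
  have hK : ∃ r, (x - y) ^ 2 ^ e = 2 * r := by
    obtain ⟨r, hr⟩ := (Commute.neg_one_right (x ^ 2)).exists_add_pow_prime_pow_eq Nat.prime_two e
    rw [← sub_eq_add_neg, hxp, Commute.mul_pow (hp x), ← hmul, hx,
      (Nat.even_pow.2 ⟨even_two, by omega⟩).neg_one_pow, neg_add_cancel, zero_add] at hr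
    refine ⟨x ^ 2 * -1 * r * y ^ 2 ^ e, ?_⟩
    have hxy' : x ^ 2 ^ e * y ^ 2 ^ e = 1 := by
      rw [← (show Commute x y from hxy.trans hyx.symm).mul_pow, hxy, one_pow]
    rw [← mul_assoc, ← mul_assoc, ← mul_assoc, ← Nat.cast_ofNat (R := R), ← hr, mul_assoc, hxy',
      mul_one]
  exact eq_one_of_odd_pow_eq_one hp hreg h2 hK eq_zero_of_forall_two_pow_dvd hg hq hgq

end CongruenceKernel

/-! ### Self-normalizing subgroups of 2-groups -/

section NormalizerGrowth

/-- Anything normalizing G conjugates x into G, so G is self-normalizing. In the nilpotent group G N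
proper subgroups grow under normalizers, so G N = G and N ≤ G; then every conjugate of x lies in N ≤
G. -/
theorem eq_top_of_isPGroup_of_forall_conj {Γ : Type*} [Group Γ] [Finite Γ] {p : ℕ}
    [Fact p.Prime] {G N : Subgroup Γ} [N.Normal] (hG : IsPGroup p G) (hN : IsPGroup p N) {x : Γ}
    (hxG : x ∈ G) (hxN : x ∈ N) (h : ∀ g, g * x * g⁻¹ ∈ G → g ∈ G) : G = ⊤ := by
  have hP : IsPGroup p (G ⊔ N : Subgroup Γ) := hG.to_sup_of_normal_right hN
  have : Group.IsNilpotent (G ⊔ N : Subgroup Γ) := hP.isNilpotent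
  have htop : G.subgroupOf (G ⊔ N) = ⊤ := by
    by_contra hne
    obtain ⟨-, hlt⟩ := SetLike.lt_iff_le_and_exists.1
      (Group.normalizerCondition_of_isNilpotent _ (lt_top_iff_ne_top.2 hne))
    obtain ⟨g, hg, hgG⟩ := hlt
    apply hgG
    rw [Subgroup.mem_subgroupOf]
    apply h
    exact (Subgroup.mem_normalizer_iff.1 hg ⟨x, Subgroup.mem_sup_left hxG⟩).1 hxG
  have hNG : N ≤ G := le_sup_right.trans (Subgroup.subgroupOf_eq_top.1 htop)
  rw [eq_top_iff]
  intro g _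
  exact h g (hNG (Subgroup.Normal.conj_mem ‹_› x hxN g))

end NormalizerGrowth

/-! ### Invariant forms and the centrality of ζ - ζ⁻¹ -/

section SymplecticOvergroups

variable {e : ℕ} {L : Type*} [Field L] [Algebra ℚ L]
  {ζ : L} {ι : Type*} [Fintype ι] [DecidableEq ι] {σ κ : L ≃ₐ[ℚ] L}

theorem exists_invariant_symmetric_form (H : Subgroup (GL ι ℚ)) [Finite H] :
    ∃ S : Matrix ι ι ℚ, IsUnit S ∧ Sᵀ = S ∧
      ∀ g ∈ H, (g : Matrix ι ι ℚ) * S * (g : Matrix ι ι ℚ)ᵀ = S := by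
  have := Fintype.ofFinite H
  let m : H → Matrix ι ι ℚ := fun h => ((h : GL ι ℚ) : Matrix ι ι ℚ)
  refine ⟨∑ h, m h * (m h)ᵀ, ?_, ?_, ?_⟩
  · rw [← mulVec_injective_iff_isUnit]
    rw [← coe_mulVecLin, injective_iff_map_eq_zero]
    intro x hx
    rw [mulVecLin_apply] at hx
    -- The averaged form is positive definite: a kernel vector makes this sum of squares vanish, and
    -- the term of the identity is x·x.
    have h1 : ∑ h, ((m h)ᵀ *ᵥ x) ⬝ᵥ ((m h)ᵀ *ᵥ x) = 0 := by
      rw [← dotProduct_zero x, ← hx, sum_mulVec, dotProduct_sum]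
      refine Finset.sum_congr rfl fun h _ => ?_
      rw [← mulVec_mulVec, dotProduct_mulVec x, ← mulVec_transpose]
    have h2 := (Finset.sum_eq_zero_iff_of_nonneg fun h _ =>
      Finset.sum_nonneg fun i _ => mul_self_nonneg _).1 h1 1 (Finset.mem_univ _)
    have h3 : (m 1)ᵀ *ᵥ x = x := by simp [m]
    rw [h3] at h2
    exact dotProduct_self_eq_zero.1 h2
  · simp [transpose_sum, transpose_mul]
  · intro g hg
    rw [Finset.mul_sum, Finset.sum_mul]
    refine Fintype.sum_equiv (Equiv.mulLeft ⟨g, hg⟩) _ _ fun h => ?_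
    simp [m, transpose_mul, Matrix.mul_assoc]

theorem GL_coe_inv_mul (g : GL ι ℚ) :
    ((g⁻¹ : GL ι ℚ) : Matrix ι ι ℚ) * (g : Matrix ι ι ℚ) = 1 := Units.inv_mul g

theorem GL_coe_mul_inv (g : GL ι ℚ) :
    (g : Matrix ι ι ℚ) * ((g⁻¹ : GL ι ℚ) : Matrix ι ι ℚ) = 1 := Units.mul_inv g

theorem mul_transpose_eq_inv_mul {g : GL ι ℚ} {S : Matrix ι ι ℚ}
    (h : (g : Matrix ι ι ℚ) * S * (g : Matrix ι ι ℚ)ᵀ = S) :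
    S * (g : Matrix ι ι ℚ)ᵀ = ((g⁻¹ : GL ι ℚ) : Matrix ι ι ℚ) * S := by
  conv_rhs => rw [← h]
  rw [← Matrix.mul_assoc, ← Matrix.mul_assoc, GL_coe_inv_mul, Matrix.one_mul]

/-- Commutativity of L makes the order reversal of the transpose harmless, so the rule extends from
ζ to all of L. -/
theorem mul_transpose_algHom [IsCyclotomicExtension {2 ^ (e + 2)} ℚ L]
    (hζ : IsPrimitiveRoot ζ (2 ^ (e + 2))) (θ : L →ₐ[ℚ] Matrix ι ι ℚ) {S : Matrix ι ι ℚ}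
    (h : S * (θ ζ)ᵀ = θ (κ ζ) * S) (a : L) : S * (θ a)ᵀ = θ (κ a) * S := by
  induction a using hζ.cyclotomic_induction with
  | alg q =>
    rw [AlgEquiv.commutes, AlgHom.commutes, Matrix.algebraMap_eq_diagonal, diagonal_transpose,
      ← Matrix.algebraMap_eq_diagonal, Algebra.commutes]
  | gen => exact h
  | add a b ha hb => simp [mul_add, add_mul, ha, hb]
  | mul a b ha hb =>
    rw [map_mul, map_mul, map_mul, transpose_mul, ← Matrix.mul_assoc, hb, Matrix.mul_assoc, ha,
      ← Matrix.mul_assoc, ← map_mul, mul_comm, map_mul]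

theorem commute_sub_inv_of_isSymplectic [IsCyclotomicExtension {2 ^ (e + 2)} ℚ L]
    (hζ : IsPrimitiveRoot ζ (2 ^ (e + 2))) (he : 1 ≤ e)
    (hσ : σ ζ = -ζ⁻¹) (θ : L →ₐ[ℚ] Matrix ι ι ℚ)
    (hdim : Module.finrank ℚ L = Fintype.card ι) {Y : Matrix ι ι ℚ}
    (hY : ∀ a, Y * θ a = θ (σ a) * Y) {v : ι → ℚ} (hv : v ≠ 0) (hYv : Y *ᵥ v = v)
    {H : Subgroup (GL ι ℚ)} [Finite H] (hH : IsSymplectic H) {x y : GL ι ℚ} (hx : x ∈ H)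
    (hy : y ∈ H) (hxθ : (x : Matrix ι ι ℚ) = θ ζ) (hyY : (y : Matrix ι ι ℚ) = Y)
    {h : GL ι ℚ} (hh : h ∈ H) :
    (h : Matrix ι ι ℚ) * θ (ζ - ζ⁻¹) = θ (ζ - ζ⁻¹) * (h : Matrix ι ι ℚ) := by
  obtain ⟨κ, hκ⟩ := hζ.exists_algEquiv_inv
  have hζ0 : ζ ≠ 0 := hζ.ne_zero (by positivity)
  have : Nontrivial (Matrix ι ι ℚ) := by
    obtain ⟨i, -⟩ := Function.ne_iff.1 hv
    have : Nonempty ι := ⟨i⟩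
    infer_instance
  obtain ⟨S, hSu, hST, hS⟩ := exists_invariant_symmetric_form H
  obtain ⟨F, hFT, hFu, hF⟩ := hH
  obtain ⟨S', hSS', hS'S⟩ := isUnit_iff_exists.1 hSu
  have hcomm : ∀ g ∈ H, (g : Matrix ι ι ℚ) * (F * S') = F * S' * (g : Matrix ι ι ℚ) := by
    intro g hg
    have h1 := mul_transpose_eq_inv_mul (hF g⁻¹ (inv_mem hg))
    have h2 := mul_transpose_eq_inv_mul (hS g⁻¹ (inv_mem hg))
    rw [inv_inv] at h1 h2
    calc (g : Matrix ι ι ℚ) * (F * S') = g * F * S' := (Matrix.mul_assoc _ _ _).symm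
      _ = F * S' * (S * ((g⁻¹ : GL ι ℚ) : Matrix ι ι ℚ)ᵀ) * S' := by
        rw [← h1, ← Matrix.mul_assoc (F * S'), Matrix.mul_assoc F S' S, hS'S, Matrix.mul_one]
      _ = F * S' * g := by
        rw [h2, Matrix.mul_assoc, Matrix.mul_assoc (g : Matrix ι ι ℚ), hSS', Matrix.mul_one]
  have hxinv : ((x⁻¹ : GL ι ℚ) : Matrix ι ι ℚ) = θ ζ⁻¹ := by
    rw [← Matrix.mul_one ((x⁻¹ : GL ι ℚ) : Matrix ι ι ℚ), ← map_one θ, ← mul_inv_cancel₀ hζ0,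
      map_mul, ← Matrix.mul_assoc, ← hxθ, GL_coe_inv_mul, Matrix.one_mul]
  obtain ⟨c, hc, hσc⟩ := exists_fixed_algHom_eq_of_commute θ hdim hY hv hYv
    (M := F * S') (by
      simpa using mul_algHom_eq_algHom_mul hζ θ AlgEquiv.refl (Y := F * S')
        (by rw [← hxθ]; simpa [hxθ] using (hcomm x hx).symm))
    (by rw [← hyY]; exact (hcomm y hy).symm)
  have hθκ := mul_transpose_algHom (κ := κ) hζ θ (S := S) (by
    rw [hκ, ← hxinv, ← hxθ]
    exact mul_transpose_eq_inv_mul (hS x hx))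
  have hFS : F = θ c * S := by rw [← hc, Matrix.mul_assoc, hS'S, Matrix.mul_one]
  have hc0 : c ≠ 0 := by
    rintro rfl
    rw [map_zero, Matrix.zero_mul] at hFS
    exact not_isUnit_zero (hFS ▸ hFu)
  -- Fᵀ = S θ(c)ᵀ = θ(κ c) S, while skewness gives Fᵀ = -θ(c) S.
  have hκc : κ c = -c := by
    apply θ.injective
    have h1 : θ (κ c) * S = -θ c * S := by
      rw [← hθκ, Matrix.neg_mul, ← hFS, ← hFT, hFS, transpose_mul, hST]
    have h2 := congrArg (· * S') h1
    simpa [Matrix.mul_assoc, hSS'] using h2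
  have hmem := hζ.sub_inv_mem_adjoin he hσ hκ hc0 hσc hκc
  have : FiniteDimensional ℚ L := IsCyclotomicExtension.finiteDimensional {2 ^ (e + 2)} ℚ L
  -- As c is algebraic, ℚ(c) = ℚ[c]: ζ - ζ⁻¹ is a polynomial in c, and θ(c) = F S⁻¹ commutes with H.
  rw [← IntermediateField.mem_toSubalgebra, IntermediateField.adjoin_simple_toSubalgebra_of_isAlgebraic
    (Algebra.IsAlgebraic.isAlgebraic c)] at hmem
  generalize ζ - ζ⁻¹ = b at hmem ⊢
  induction hmem using Algebra.adjoin_induction with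
  | mem a ha => rw [Set.mem_singleton_iff.1 ha, ← hc]; exact hcomm h hh
  | algebraMap q => rw [AlgHom.commutes, Algebra.commutes]
  | add a b _ _ ha hb => rw [map_add, mul_add, add_mul, ha, hb]
  | mul a b _ _ ha hb => rw [map_mul, ← mul_assoc, ha, mul_assoc, hb, mul_assoc]

theorem exists_eq_pow_of_commute_of_isOfFinOrder [IsCyclotomicExtension {2 ^ (e + 2)} ℚ L]
    (hζ : IsPrimitiveRoot ζ (2 ^ (e + 2))) (θ : L →ₐ[ℚ] Matrix ι ι ℚ)
    (hdim : Module.finrank ℚ L = Fintype.card ι) {v : ι → ℚ} (hv : v ≠ 0)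
    {M : Matrix ι ι ℚ} (hM : M * θ ζ = θ ζ * M) (hfin : IsOfFinOrder M) :
    ∃ k, M = θ (ζ ^ k) := by
  have : Nontrivial (Matrix ι ι ℚ) := by
    obtain ⟨i, -⟩ := Function.ne_iff.1 hv
    have : Nonempty ι := ⟨i⟩
    infer_instance
  obtain ⟨c, rfl⟩ := exists_algHom_eq_of_commute θ hdim hv (M := M) (by
      simpa using mul_algHom_eq_algHom_mul hζ θ AlgEquiv.refl (Y := M) (by simpa using hM))
  obtain ⟨k, hk⟩ := hζ.exists_pow_eq_of_isOfFinOrder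
    ((Function.Injective.isOfFinOrder_iff (f := (θ : L →* Matrix ι ι ℚ)) θ.injective).1 hfin)
  exact ⟨k, by rw [hk]⟩

theorem exists_eq_pow_or_of_conj_sq [IsCyclotomicExtension {2 ^ (e + 2)} ℚ L]
    (hζ : IsPrimitiveRoot ζ (2 ^ (e + 2)))
    (hσ : σ ζ = -ζ⁻¹) (θ : L →ₐ[ℚ] Matrix ι ι ℚ)
    (hdim : Module.finrank ℚ L = Fintype.card ι) {Y : Matrix ι ι ℚ} (hYY : Y * Y = 1)
    (hY : ∀ a, Y * θ a = θ (σ a) * Y) {v : ι → ℚ} (hv : v ≠ 0)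
    {h : Matrix ι ι ℚ} (hu : IsUnit h) (hfin : IsOfFinOrder h) (hfin' : IsOfFinOrder (Y * h))
    (hcomm : h * θ (ζ - ζ⁻¹) = θ (ζ - ζ⁻¹) * h) {a : L} (hconj : h * θ (ζ ^ 2) = θ a * h) :
    ∃ k, h = θ (ζ ^ k) ∨ h = θ (ζ ^ k) * Y := by
  have : Nontrivial (Matrix ι ι ℚ) := by
    obtain ⟨i, -⟩ := Function.ne_iff.1 hv
    have : Nonempty ι := ⟨i⟩
    infer_instance
  have hζ0 : ζ ≠ 0 := hζ.ne_zero (by positivity)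
  have hsq : ζ ^ 2 = 1 + ζ * (ζ - ζ⁻¹) := by field_simp; ring
  have hπ : ζ - ζ⁻¹ ≠ 0 := by
    intro h0
    rw [h0, mul_zero, add_zero] at hsq
    have := Nat.le_of_dvd two_pos ((hζ.pow_eq_one_iff_dvd 2).1 hsq)
    have : 2 ^ 2 ≤ 2 ^ (e + 2) := Nat.pow_le_pow_right two_pos (by omega)
    omega
  -- Since ζ² = 1 + ζ π and h commutes with π, knowing h ζ² h⁻¹ = a determines h ζ h⁻¹ = d in L.
  set d := (a - 1) / (ζ - ζ⁻¹) with hd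
  have had : a = 1 + d * (ζ - ζ⁻¹) := by rw [hd, div_mul_cancel₀ _ hπ]; ring
  have hhd : h * θ ζ = θ d * h := by
    apply (isUnit_algHom θ hπ).mul_right_cancel
    have h1 := hconj
    rw [hsq, had, map_add, map_add, map_mul, map_mul, map_one, mul_add, add_mul, mul_one, one_mul,
      add_right_inj, ← mul_assoc, mul_assoc (θ d), ← hcomm, ← mul_assoc] at h1
    exact h1
  have hquad : d * d - (ζ - ζ⁻¹) * d - 1 = 0 := by
    apply θ.injective
    apply hu.mul_right_cancel
    have h0 : ζ * ζ - (ζ - ζ⁻¹) * ζ - 1 = 0 := by field_simp; ring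
    have h1 : h * θ (ζ * ζ - (ζ - ζ⁻¹) * ζ - 1) = 0 := by rw [h0, map_zero, mul_zero]
    rw [map_zero, zero_mul, ← h1]
    rw [map_sub, map_sub, map_mul, map_mul, map_one, map_sub θ (ζ * ζ - _), map_sub θ (ζ * ζ),
      map_mul, map_mul, map_one]
    rw [mul_sub, mul_sub, sub_mul, sub_mul, ← mul_assoc h, ← mul_assoc h, hhd, hcomm,
      mul_assoc _ h, mul_assoc _ h, hhd]
    simp [mul_assoc]
  rcases hζ.eq_or_eq_of_sub_inv hquad with h1 | h1
  · rw [h1] at hhd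
    obtain ⟨k, hk⟩ := exists_eq_pow_of_commute_of_isOfFinOrder hζ θ hdim hv hhd hfin
    exact ⟨k, Or.inl hk⟩
  · have hYh : Y * h * θ ζ = θ ζ * (Y * h) := by
      rw [mul_assoc, hhd, h1, ← mul_assoc, hY, map_neg, map_inv₀, hσ, inv_neg, inv_inv, neg_neg,
        mul_assoc]
    obtain ⟨k, hk⟩ := exists_eq_pow_of_commute_of_isOfFinOrder hζ θ hdim hv hYh hfin'
    -- Here h = Y θ(ζ^k); moving Y to the right turns ζ^k into σ(ζ)^k = ζ^(sk).
    obtain ⟨s, -, hs⟩ := hζ.exists_odd_pow σ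
    refine ⟨s * k, Or.inr ?_⟩
    rw [pow_mul, ← hs, ← map_pow, ← hY, ← hk, ← mul_assoc, hYY, one_mul]

end SymplecticOvergroups

/-! ### The congruence subgroup and maximality -/

section SymplecticOvergroups

variable {e : ℕ} {L : Type*} [Field L] [Algebra ℚ L]
  {ζ : L} {ι : Type*} [Fintype ι] [DecidableEq ι] {σ : L ≃ₐ[ℚ] L}

/-- The subring of integral combinations of elements of a matrix group. -/
def integralSpan (H : Subgroup (GL ι ℚ)) : Subalgebra ℤ (Matrix ι ι ℚ) :=
  Algebra.adjoin ℤ ((fun g : GL ι ℚ => (g : Matrix ι ι ℚ)) '' (H : Set (GL ι ℚ)))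

theorem coe_mem_integralSpan {H : Subgroup (GL ι ℚ)} {g : GL ι ℚ} (hg : g ∈ H) :
    (g : Matrix ι ι ℚ) ∈ integralSpan H :=
  Algebra.subset_adjoin ⟨g, hg, rfl⟩

theorem finite_integralSpan (H : Subgroup (GL ι ℚ)) [Finite H] :
    Module.Finite ℤ (integralSpan H) := by
  have hclosure : (Submonoid.closure ((fun g : GL ι ℚ => (g : Matrix ι ι ℚ)) ''
      (H : Set (GL ι ℚ))) : Set (Matrix ι ι ℚ)) =
      (fun g : GL ι ℚ => (g : Matrix ι ι ℚ)) '' (H : Set (GL ι ℚ)) := by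
    have h : (fun g : GL ι ℚ => (g : Matrix ι ι ℚ)) '' (H : Set (GL ι ℚ)) =
        (H.toSubmonoid.map (Units.coeHom (Matrix ι ι ℚ)) : Set (Matrix ι ι ℚ)) := rfl
    rw [h, Submonoid.closure_eq]
  have hfg : (Subalgebra.toSubmodule (integralSpan H)).FG := by
    rw [integralSpan, Algebra.adjoin_eq_span, hclosure]
    exact Submodule.fg_span (Set.Finite.image _ (Set.toFinite _))
  exact Module.Finite.iff_fg.2 hfg

/-- The elements of a matrix group `H` congruent to `1` modulo a matrix `P`. -/
def congruenceSubgroup (H : Subgroup (GL ι ℚ)) (P : Matrix ι ι ℚ) : Subgroup H where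
  carrier := {h | ∃ r ∈ integralSpan H, ((h : GL ι ℚ) : Matrix ι ι ℚ) = 1 + P * r}
  one_mem' := ⟨0, zero_mem _, by simp⟩
  mul_mem' := by
    rintro g h ⟨r, hr, hg⟩ ⟨s, hs, hh⟩
    refine ⟨r * (h : GL ι ℚ) + s, add_mem (mul_mem hr (coe_mem_integralSpan h.2)) hs, ?_⟩
    rw [Subgroup.coe_mul, Units.val_mul, hg, add_mul, one_mul, mul_add, ← mul_assoc]
    nth_rewrite 1 [hh]
    rw [add_comm (P * r * _), add_assoc]
  inv_mem' := by
    rintro g ⟨r, hr, hg⟩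
    refine ⟨-(r * ((g⁻¹ : H) : GL ι ℚ)), neg_mem (mul_mem hr (coe_mem_integralSpan (g⁻¹).2)), ?_⟩
    have h1 := congrArg (· * (((g⁻¹ : H) : GL ι ℚ) : Matrix ι ι ℚ)) hg
    simp only [Subgroup.coe_inv, GL_coe_mul_inv, add_mul, one_mul] at h1 ⊢
    rw [h1, mul_neg, mul_assoc, add_neg_cancel_right]

theorem congruenceSubgroup_normal (H : Subgroup (GL ι ℚ)) (P : Matrix ι ι ℚ)
    (hP : ∀ h ∈ H, (h : Matrix ι ι ℚ) * P = P * h) : (congruenceSubgroup H P).Normal where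
  conj_mem := by
    rintro g ⟨r, hr, hg⟩ h
    refine ⟨(h : GL ι ℚ) * r * ((h⁻¹ : H) : GL ι ℚ),
      mul_mem (mul_mem (coe_mem_integralSpan h.2) hr) (coe_mem_integralSpan (h⁻¹).2), ?_⟩
    simp only [Subgroup.coe_mul, Units.val_mul, Subgroup.coe_inv]
    rw [hg, mul_add, mul_one, add_mul, GL_coe_mul_inv, ← mul_assoc, hP h h.2]
    simp only [mul_assoc]

theorem isPGroup_congruenceSubgroup (he : 1 ≤ e) {H : Subgroup (GL ι ℚ)} [Finite H]
    {x : GL ι ℚ} (hx : x ∈ H) (hxpow : (x : Matrix ι ι ℚ) ^ 2 ^ (e + 1) = -1)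
    (hP : ∀ h ∈ H, (h : Matrix ι ι ℚ) * ((x : Matrix ι ι ℚ) - (x⁻¹ : GL ι ℚ)) =
      ((x : Matrix ι ι ℚ) - (x⁻¹ : GL ι ℚ)) * h) :
    IsPGroup 2 (congruenceSubgroup H ((x : Matrix ι ι ℚ) - (x⁻¹ : GL ι ℚ))) := by
  have := finite_integralSpan H
  have : Module.IsTorsionFree ℤ (integralSpan H) :=
    have : Module.IsTorsionFree ℤ (Matrix ι ι ℚ) :=
      inferInstanceAs (Module.IsTorsionFree ℤ (ι → ι → ℚ))
    Subtype.val_injective.moduleIsTorsionFree _ fun _ _ => rfl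
  let X : integralSpan H := ⟨x, coe_mem_integralSpan hx⟩
  let X' : integralSpan H := ⟨(x⁻¹ : GL ι ℚ), coe_mem_integralSpan (inv_mem hx)⟩
  have hcentral : ∀ r : integralSpan H, (X - X') * r = r * (X - X') := by
    rintro ⟨r, hr⟩
    apply Subtype.ext
    change ((x : Matrix ι ι ℚ) - (x⁻¹ : GL ι ℚ)) * r = r * ((x : Matrix ι ι ℚ) - (x⁻¹ : GL ι ℚ))
    induction hr using Algebra.adjoin_induction with
    | mem a ha => obtain ⟨h, hh, rfl⟩ := ha; exact (hP h hh).symm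
    | algebraMap q => exact (Algebra.commutes q _).symm
    | add a b _ _ ha hb => rw [mul_add, add_mul, ha, hb]
    | mul a b _ _ ha hb => rw [← mul_assoc, ha, mul_assoc, hb, mul_assoc]
  rintro ⟨g, hg⟩
  -- The 2^k-th power of g has odd order and remains congruent to 1, hence is trivial.
  obtain ⟨k, q, hq, hkq⟩ := Nat.exists_eq_two_pow_mul_odd (orderOf_pos g).ne'
  refine ⟨k, Subtype.ext ?_⟩
  obtain ⟨r, hr, hgr⟩ := pow_mem hg (2 ^ k)
  let γ : integralSpan H := ⟨((g ^ 2 ^ k : H) : GL ι ℚ), coe_mem_integralSpan (g ^ 2 ^ k).2⟩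
  have hγ : γ = 1 := by
    refine eq_one_of_odd_pow_eq_one_of_sub_inv he (x := X) (y := X')
      (Subtype.ext (GL_coe_mul_inv x)) (Subtype.ext (GL_coe_inv_mul x)) (Subtype.ext hxpow)
      hcentral ⟨⟨r, hr⟩, Subtype.ext hgr⟩ hq (Subtype.ext ?_)
    have h1 : (g ^ 2 ^ k) ^ q = 1 := by rw [← pow_mul, ← hkq, pow_orderOf_eq_one]
    have h2 := congrArg (fun h : H => ((h : GL ι ℚ) : Matrix ι ι ℚ)) h1
    simpa [γ] using h2
  exact Subtype.ext (Units.ext (congrArg Subtype.val hγ))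

theorem le_of_isSymplectic_of_le [IsCyclotomicExtension {2 ^ (e + 2)} ℚ L]
    (hζ : IsPrimitiveRoot ζ (2 ^ (e + 2))) (he : 2 ≤ e)
    (hσ : σ ζ = -ζ⁻¹) (θ : L →ₐ[ℚ] Matrix ι ι ℚ)
    (hdim : Module.finrank ℚ L = Fintype.card ι) {Y : Matrix ι ι ℚ} (hYY : Y * Y = 1)
    (hY : ∀ a, Y * θ a = θ (σ a) * Y) {v : ι → ℚ} (hv : v ≠ 0) (hYv : Y *ᵥ v = v)
    {G H : Subgroup (GL ι ℚ)} (hG : ∀ g : GL ι ℚ, g ∈ G ↔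
      ∃ k, (g : Matrix ι ι ℚ) = θ (ζ ^ k) ∨ (g : Matrix ι ι ℚ) = θ (ζ ^ k) * Y)
    (hfinite : Finite H) (hH : IsSymplectic H) (hGH : G ≤ H) : H ≤ G := by
  have : Nontrivial (Matrix ι ι ℚ) := by
    obtain ⟨i, -⟩ := Function.ne_iff.1 hv
    have : Nonempty ι := ⟨i⟩
    infer_instance
  have hζ0 : ζ ≠ 0 := hζ.ne_zero (by positivity)
  obtain ⟨x, hx⟩ : ∃ x : GL ι ℚ, (x : Matrix ι ι ℚ) = θ ζ := isUnit_algHom θ hζ0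
  obtain ⟨y, hy⟩ : ∃ y : GL ι ℚ, (y : Matrix ι ι ℚ) = Y := ⟨⟨Y, Y, hYY, hYY⟩, rfl⟩
  have hxG : x ∈ G := (hG x).2 ⟨1, Or.inl (by rw [hx, pow_one])⟩
  have hyG : y ∈ G := (hG y).2 ⟨0, Or.inr (by rw [hy, pow_zero, map_one, one_mul])⟩
  have hxinv : ((x⁻¹ : GL ι ℚ) : Matrix ι ι ℚ) = θ ζ⁻¹ := by
    rw [← Matrix.mul_one ((x⁻¹ : GL ι ℚ) : Matrix ι ι ℚ), ← map_one θ, ← mul_inv_cancel₀ hζ0,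
      map_mul, ← Matrix.mul_assoc, ← hx, GL_coe_inv_mul, Matrix.one_mul]
  have hπ : θ (ζ - ζ⁻¹) = (x : Matrix ι ι ℚ) - (x⁻¹ : GL ι ℚ) := by rw [map_sub, hx, hxinv]
  have hcomm := fun h (hh : h ∈ H) => commute_sub_inv_of_isSymplectic hζ (by omega) hσ θ hdim hY hv
    hYv hH (hGH hxG) (hGH hyG) hx hy hh
  have hP := hcomm
  rw [hπ] at hP
  have hxpow : (x : Matrix ι ι ℚ) ^ 2 ^ (e + 1) = -1 := by
    rw [hx, ← map_pow, hζ.pow_two_pow_eq_neg_one, map_neg, map_one]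
  have hN := isPGroup_congruenceSubgroup (by omega) (hGH hxG) hxpow hP
  have := congruenceSubgroup_normal H _ hP
  have hfin : ∀ h ∈ H, IsOfFinOrder (h : Matrix ι ι ℚ) := by
    intro h hh
    have h1 : IsOfFinOrder (⟨h, hh⟩ : H) := isOfFinOrder_of_finite _
    have h2 := (Units.coeHom (Matrix ι ι ℚ)).isOfFinOrder (H.subtype.isOfFinOrder h1)
    exact h2
  -- The square is ζ^k σ(ζ^k) = (-1)^k.
  have hsq : ∀ k, (θ (ζ ^ k) * Y) ^ 4 = 1 := by
    intro k
    have h1 : (θ (ζ ^ k) * Y) ^ 2 = θ ((-1) ^ k) := by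
      rw [pow_two, mul_assoc, ← mul_assoc Y, hY, mul_assoc (θ (σ _)), hYY, mul_one, ← map_mul,
        map_pow, hσ, ← mul_pow, mul_neg, mul_inv_cancel₀ hζ0]
    rw [show 4 = 2 * 2 from rfl, pow_mul, h1, ← map_pow, ← pow_mul, mul_comm k 2, pow_mul]
    simp
  have hpow : ∀ k, θ (ζ ^ k) ^ 2 ^ (e + 2) = 1 := by
    intro k
    rw [← map_pow, ← pow_mul, mul_comm, pow_mul, hζ.pow_eq_one, one_pow, map_one]
  have hGp : IsPGroup 2 (G.subgroupOf H) := by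
    rintro ⟨⟨g, hgH⟩, hg⟩
    refine ⟨e + 2, Subtype.ext (Subtype.ext (Units.ext ?_))⟩
    change (g : Matrix ι ι ℚ) ^ 2 ^ (e + 2) = 1
    obtain ⟨k, hk | hk⟩ := (hG g).1 hg
    · rw [hk, hpow]
    · rw [hk, pow_add, mul_comm, pow_mul, show (2 : ℕ) ^ 2 = 4 from rfl, hsq, one_pow]
  have hconj : ∀ g : H, g * ⟨x ^ 2, hGH (pow_mem hxG 2)⟩ * g⁻¹ ∈ G.subgroupOf H →
      g ∈ G.subgroupOf H := by
    rintro ⟨h, hh⟩ hmem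
    rw [Subgroup.mem_subgroupOf] at hmem ⊢
    change h * x ^ 2 * h⁻¹ ∈ G at hmem
    change h ∈ G
    obtain ⟨k, hk | hk⟩ := (hG _).1 hmem
    · refine (hG h).2 (exists_eq_pow_or_of_conj_sq hζ hσ θ hdim hYY hY hv h.isUnit (hfin h hh)
        ?_ (hcomm h hh) (a := ζ ^ k) ?_)
      · rw [← hy, ← Units.val_mul]
        exact hfin _ (mul_mem (hGH hyG) hh)
      · rw [← hk, map_pow, ← hx, ← Units.val_pow_eq_pow_val, ← Units.val_mul, ← Units.val_mul,
          inv_mul_cancel_right]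
    -- Here e ≥ 2 matters: x² has order 2^(e+1) ≥ 8, so it is not conjugate to an element of order
    -- dividing 4.
    · exfalso
      have h4 : (h * x ^ 2 * h⁻¹) ^ 4 = 1 := by
        apply Units.ext
        rw [Units.val_pow_eq_pow_val, hk, hsq, Units.val_one]
      rw [conj_pow, ← pow_mul] at h4
      have h5 : x ^ 8 = 1 := by simpa [mul_inv_eq_one] using h4
      have h6 : ζ ^ 8 = 1 := by
        have h7 : θ (ζ ^ 8) = θ 1 := by
          rw [map_pow, ← hx, ← Units.val_pow_eq_pow_val, h5, map_one, Units.val_one]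
        exact θ.injective h7
      have := Nat.le_of_dvd (by norm_num) ((hζ.pow_eq_one_iff_dvd 8).1 h6)
      have : 2 ^ 4 ≤ 2 ^ (e + 2) := Nat.pow_le_pow_right two_pos (by omega)
      omega
  refine Subgroup.subgroupOf_eq_top.1 (eq_top_of_isPGroup_of_forall_conj hGp hN
    (pow_mem hxG 2) ?_ hconj)
  refine ⟨x, coe_mem_integralSpan (hGH hxG), ?_⟩
  change ((x ^ 2 : GL ι ℚ) : Matrix ι ι ℚ) = _
  rw [sub_mul, GL_coe_inv_mul, Units.val_pow_eq_pow_val, pow_two, add_sub_cancel]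

end SymplecticOvergroups

/-! ### Normal form of a skew-symmetric matrix -/

section Darboux

variable {K V : Type*} [Field K] [AddCommGroup V] [Module K V] [FiniteDimensional K V]

/-- An alternating nondegenerate form on a space of dimension at least `2 * j` admits `j` mutually
orthogonal hyperbolic pairs. -/
theorem exists_hyperbolic_pairs (B : V →ₗ[K] V →ₗ[K] K) (hB : B.IsAlt)
    (hnd : ∀ v, v ≠ 0 → ∃ w, B v w ≠ 0) (j : ℕ) (hj : 2 * j ≤ Module.finrank K V) :
    ∃ a b : Fin j → V, (∀ i i', B (a i) (a i') = 0) ∧ (∀ i i', B (b i) (b i') = 0) ∧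
      ∀ i i', B (a i) (b i') = if i = i' then 1 else 0 := by
  induction j with
  | zero => exact ⟨Fin.elim0, Fin.elim0, fun i => i.elim0, fun i => i.elim0, fun i => i.elim0⟩
  | succ j ih =>
    obtain ⟨a, b, haa, hbb, hab⟩ := ih (by omega)
    have hswap : ∀ v w, B w v = -B v w := fun v w => (hB.neg v w).symm
    let f : V →ₗ[K] (Fin j → K) × (Fin j → K) :=
      (LinearMap.pi fun i => B (a i)).prod (LinearMap.pi fun i => B (b i))
    have hker : LinearMap.ker f ≠ ⊥ := by
      apply LinearMap.ker_ne_bot_of_finrank_lt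
      simp only [Module.finrank_prod, Module.finrank_fintype_fun_eq_card, Fintype.card_fin]
      omega
    obtain ⟨v, hvf, hv⟩ := Submodule.exists_mem_ne_zero_of_ne_bot hker
    have hav : ∀ i, B (a i) v = 0 := fun i => congrFun (congrArg Prod.fst hvf) i
    have hbv : ∀ i, B (b i) v = 0 := fun i => congrFun (congrArg Prod.snd hvf) i
    obtain ⟨w, hw⟩ := hnd v hv
    let w' := (B v w)⁻¹ • w
    have hvw' : B v w' = 1 := by simp [w', hw]
    -- Symplectic Gram–Schmidt: the correction makes the partner of v orthogonal to the old pairs,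
    -- and v pairs to zero with it.
    let u := w' + ∑ i, B (b i) w' • a i - ∑ i, B (a i) w' • b i
    have hau : ∀ i, B (a i) u = 0 := by
      intro i
      simp [u, haa, hab]
    have hbu : ∀ i, B (b i) u = 0 := by
      intro i
      simp [u, hbb, hswap (a _) (b i), hab]
    have hvu : B v u = 1 := by
      simp [u, hvw', hswap (a _) v, hswap (b _) v, hav, hbv]
    refine ⟨Fin.cons v a, Fin.cons u b, ?_, ?_, ?_⟩
    · intro i i'
      refine Fin.cases ?_ (fun i => ?_) i <;> refine Fin.cases ?_ (fun i' => ?_) i' <;>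
        simp [haa, hav, hswap (a _) v, hB.self_eq_zero]
    · intro i i'
      refine Fin.cases ?_ (fun i => ?_) i <;> refine Fin.cases ?_ (fun i' => ?_) i' <;>
        simp [hbb, hbu, hswap (b _) u, hB.self_eq_zero]
    · intro i i'
      refine Fin.cases ?_ (fun i => ?_) i <;> refine Fin.cases ?_ (fun i' => ?_) i' <;>
        simp [hab, hvu, hau, hswap (b _) v, hbv, Fin.succ_ne_zero, (Fin.succ_ne_zero _).symm]

/-- Every invertible skew-symmetric rational matrix is congruent to the standard one. -/
theorem exists_congruent_J {k : ℕ} {F : Matrix (Fin k ⊕ Fin k) (Fin k ⊕ Fin k) ℚ}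
    (hFT : Fᵀ = -F) (hF : IsUnit F) :
    ∃ T : GL (Fin k ⊕ Fin k) ℚ, (T : Matrix (Fin k ⊕ Fin k) (Fin k ⊕ Fin k) ℚ) * F *
      (T : Matrix (Fin k ⊕ Fin k) (Fin k ⊕ Fin k) ℚ)ᵀ = Matrix.J (Fin k) ℚ := by
  let B : (Fin k ⊕ Fin k → ℚ) →ₗ[ℚ] (Fin k ⊕ Fin k → ℚ) →ₗ[ℚ] ℚ := Matrix.toLinearMap₂' ℚ F
  have hBF : ∀ v w, B v w = v ⬝ᵥ F *ᵥ w := fun v w => Matrix.toLinearMap₂'_apply' F v w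
  have hB : B.IsAlt := by
    intro v
    have h1 : B v v = -B v v := by
      conv_lhs => rw [hBF, dotProduct_mulVec, ← mulVec_transpose, hFT, neg_mulVec,
        neg_dotProduct, dotProduct_comm, ← hBF]
    exact self_eq_neg.1 h1
  have hnd : ∀ v, v ≠ 0 → ∃ w, B v w ≠ 0 := by
    intro v hv
    by_contra! h
    apply hv
    have h1 : F *ᵥ v = 0 := by
      ext i
      have h2 := h (Pi.single i 1)
      rw [← hB.neg, hBF, single_one_dotProduct] at h2
      simpa using h2
    exact mulVec_injective_iff_isUnit.2 hF (by rw [h1, mulVec_zero])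
  obtain ⟨a, b, haa, hbb, hab⟩ := exists_hyperbolic_pairs B hB hnd k (by simp; omega)
  -- The b's come first because `Matrix.J` has -1 in its upper right block.
  let T : Matrix (Fin k ⊕ Fin k) (Fin k ⊕ Fin k) ℚ := Matrix.of (Sum.elim b a)
  have hT : T * F * Tᵀ = Matrix.J (Fin k) ℚ := by
    have key : ∀ i j, (T * F * Tᵀ) i j = B (Sum.elim b a i) (Sum.elim b a j) := by
      intro i j
      rw [hBF, Matrix.mul_assoc]
      rfl
    ext i j
    rw [key]
    rcases i with i | i <;> rcases j with j | j
    · simp [Matrix.J, hbb]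
    · simp [Matrix.J, ← hB.neg (a j) (b i), hab, Matrix.one_apply, eq_comm]
    · simp [Matrix.J, hab, Matrix.one_apply]
    · simp [Matrix.J, haa]
  have hTu : IsUnit T := by
    rw [Matrix.isUnit_iff_isUnit_det]
    have h1 := Matrix.isUnit_det_J (Fin k) ℚ
    rw [← hT, det_mul, det_mul, mul_assoc] at h1
    exact isUnit_of_mul_isUnit_left h1
  obtain ⟨T', hT'⟩ := hTu
  exact ⟨T', by rw [hT', hT]⟩

end Darboux

/-! ### Normal forms from the quasidihedral relations -/

section QuasiDihedralRelations

variable {M : Type*} [Group M] {a b : M} {N u : ℕ}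

theorem mul_eq_pow_mul_iff_of_mul_self (hb : b * b = 1) :
    b * a = a ^ u * b ↔ b⁻¹ * a * b * (a ^ u)⁻¹ = 1 := by
  rw [inv_eq_of_mul_eq_one_right hb, mul_inv_eq_one]
  constructor
  · intro h; rw [h, mul_assoc, hb, mul_one]
  · intro h; rw [← h, mul_assoc, hb, mul_one]

theorem mul_pow_eq_pow_mul_of_mul_eq (hab : b * a = a ^ u * b) (k : ℕ) :
    b * a ^ k = a ^ (u * k) * b := by
  induction k with
  | zero => simp
  | succ k ih => rw [pow_succ, ← mul_assoc, ih, mul_assoc, hab, ← mul_assoc, ← pow_add, mul_add,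
      mul_one]

theorem exists_eq_pow_or_of_mem_closure (hN : 1 ≤ N) (ha : a ^ N = 1) (hb : b * b = 1)
    (hab : b * a = a ^ u * b) {g : M} (hg : g ∈ Subgroup.closure {a, b}) :
    ∃ k, g = a ^ k ∨ g = a ^ k * b := by
  have hx : ∀ k, (a ^ k)⁻¹ = a ^ (k * (N - 1)) := by
    intro k
    rw [inv_eq_iff_mul_eq_one, ← pow_add]
    nth_rewrite 1 [← mul_one k]
    rw [← mul_add, Nat.add_sub_cancel' hN, mul_comm, pow_mul, ha, one_pow]
  induction hg using Subgroup.closure_induction with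
  | mem c hc =>
    rcases hc with rfl | hc
    · exact ⟨1, Or.inl (pow_one _).symm⟩
    · exact ⟨0, Or.inr (by rw [pow_zero, one_mul]; exact hc)⟩
  | one => exact ⟨0, Or.inl (pow_zero _).symm⟩
  | mul c d _ _ hc hd =>
    obtain ⟨k, rfl | rfl⟩ := hc <;> obtain ⟨l, rfl | rfl⟩ := hd
    · exact ⟨k + l, Or.inl (pow_add _ _ _).symm⟩
    · exact ⟨k + l, Or.inr (by rw [pow_add, mul_assoc])⟩
    · exact ⟨k + u * l, Or.inr (by
        rw [mul_assoc, mul_pow_eq_pow_mul_of_mul_eq hab, pow_add, mul_assoc])⟩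
    · exact ⟨k + u * l, Or.inl (by
        rw [mul_assoc, ← mul_assoc b, mul_pow_eq_pow_mul_of_mul_eq hab, pow_add, mul_assoc, hb,
          mul_one])⟩
  | inv c _ hc =>
    obtain ⟨k, rfl | rfl⟩ := hc
    · exact ⟨_, Or.inl (hx k)⟩
    · exact ⟨_, Or.inr (by
        rw [_root_.mul_inv_rev, hx, inv_eq_of_mul_eq_one_right hb,
          mul_pow_eq_pow_mul_of_mul_eq hab])⟩

theorem finite_of_closure_eq_top (hN : 1 ≤ N) (ha : a ^ N = 1) (hb : b * b = 1)
    (hab : b * a = a ^ u * b) (htop : Subgroup.closure {a, b} = ⊤) : Finite M := by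
  have hfin : Finite (Subgroup.zpowers a) :=
    finite_zpowers.2 (isOfFinOrder_iff_pow_eq_one.2 ⟨N, hN, ha⟩)
  refine Finite.of_surjective (fun p : Subgroup.zpowers a × Bool =>
    if p.2 then (p.1 : M) else p.1 * b) fun g => ?_
  obtain ⟨k, rfl | rfl⟩ := exists_eq_pow_or_of_mem_closure hN ha hb hab (g := g) (by simp [htop])
  · exact ⟨(⟨_, Subgroup.npow_mem_zpowers _ k⟩, true), rfl⟩
  · exact ⟨(⟨_, Subgroup.npow_mem_zpowers _ k⟩, false), rfl⟩

end QuasiDihedralRelations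

/-! ### The presented group and its universal property -/

namespace QuasiDihedral

variable {e : ℕ}

/-- The generator of order `2 ^ (n - 1)`. -/
def x (n : ℕ) : QuasiDihedral n := PresentedGroup.of 0

/-- The noncentral involution among the generators. -/
def y (n : ℕ) : QuasiDihedral n := PresentedGroup.of 1

theorem x_pow (e : ℕ) : x (e + 3) ^ 2 ^ (e + 2) = 1 := by
  have h := PresentedGroup.one_of_mem (rels := ({FreeGroup.of 0 ^ (2 ^ (e + 3 - 1)),
    FreeGroup.of 1 ^ 2, (FreeGroup.of 1)⁻¹ * FreeGroup.of 0 * FreeGroup.of 1 *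
      (FreeGroup.of 0 ^ (2 ^ (e + 3 - 2) - 1))⁻¹} : Set (FreeGroup (Fin 2))))
    (x := FreeGroup.of 0 ^ (2 ^ (e + 3 - 1))) (by simp)
  rwa [map_pow] at h

theorem y_mul_y (e : ℕ) : y (e + 3) * y (e + 3) = 1 := by
  have h := PresentedGroup.one_of_mem (rels := ({FreeGroup.of 0 ^ (2 ^ (e + 3 - 1)),
    FreeGroup.of 1 ^ 2, (FreeGroup.of 1)⁻¹ * FreeGroup.of 0 * FreeGroup.of 1 *
      (FreeGroup.of 0 ^ (2 ^ (e + 3 - 2) - 1))⁻¹} : Set (FreeGroup (Fin 2))))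
    (x := FreeGroup.of 1 ^ 2) (by simp)
  rwa [map_pow, pow_two] at h

theorem y_mul_x (e : ℕ) :
    y (e + 3) * x (e + 3) = x (e + 3) ^ (2 ^ (e + 1) - 1) * y (e + 3) := by
  have h := PresentedGroup.one_of_mem (rels := ({FreeGroup.of 0 ^ (2 ^ (e + 3 - 1)),
    FreeGroup.of 1 ^ 2, (FreeGroup.of 1)⁻¹ * FreeGroup.of 0 * FreeGroup.of 1 *
      (FreeGroup.of 0 ^ (2 ^ (e + 3 - 2) - 1))⁻¹} : Set (FreeGroup (Fin 2))))
    (x := (FreeGroup.of 1)⁻¹ * FreeGroup.of 0 * FreeGroup.of 1 *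
      (FreeGroup.of 0 ^ (2 ^ (e + 3 - 2) - 1))⁻¹) (by simp)
  rw [map_mul, map_mul, map_mul, map_inv, map_inv, map_pow] at h
  change (y (e + 3))⁻¹ * x (e + 3) * y (e + 3) * (x (e + 3) ^ (2 ^ (e + 1) - 1))⁻¹ = 1 at h
  exact (mul_eq_pow_mul_iff_of_mul_self (y_mul_y e)).2 h

theorem closure_eq_top (e : ℕ) : Subgroup.closure {x (e + 3), y (e + 3)} = ⊤ := by
  rw [eq_top_iff, ← PresentedGroup.closure_range_of]
  apply Subgroup.closure_mono
  rintro _ ⟨i, rfl⟩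
  fin_cases i
  · exact Or.inl rfl
  · exact Or.inr rfl

theorem exists_eq_pow (g : QuasiDihedral (e + 3)) :
    ∃ k, g = x (e + 3) ^ k ∨ g = x (e + 3) ^ k * y (e + 3) :=
  exists_eq_pow_or_of_mem_closure Nat.one_le_two_pow (x_pow e) (y_mul_y e) (y_mul_x e)
    (by rw [closure_eq_top]; trivial)

instance (e : ℕ) : Finite (QuasiDihedral (e + 3)) :=
  finite_of_closure_eq_top Nat.one_le_two_pow (x_pow e) (y_mul_y e) (y_mul_x e) (closure_eq_top e)

theorem hom_ext {M : Type*} [Group M] {f g : QuasiDihedral (e + 3) →* M}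
    (hx : f (x (e + 3)) = g (x (e + 3))) (hy : f (y (e + 3)) = g (y (e + 3))) : f = g := by
  apply PresentedGroup.ext
  intro i
  fin_cases i
  · exact hx
  · exact hy

theorem exists_hom {M : Type*} [Group M] {a b : M} (ha : a ^ 2 ^ (e + 2) = 1) (hb : b * b = 1)
    (hab : b * a = a ^ (2 ^ (e + 1) - 1) * b) :
    ∃ f : QuasiDihedral (e + 3) →* M, f (x (e + 3)) = a ∧ f (y (e + 3)) = b := by
  have hrel : ∀ r ∈ ({FreeGroup.of 0 ^ (2 ^ (e + 3 - 1)),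
      FreeGroup.of 1 ^ 2, (FreeGroup.of 1)⁻¹ * FreeGroup.of 0 * FreeGroup.of 1 *
      (FreeGroup.of 0 ^ (2 ^ (e + 3 - 2) - 1))⁻¹} : Set (FreeGroup (Fin 2))),
      FreeGroup.lift ![a, b] r = 1 := by
    intro r hr
    simp only [Set.mem_insert_iff, Set.mem_singleton_iff] at hr
    rcases hr with rfl | rfl | rfl
    · simpa using ha
    · simpa [pow_two] using hb
    · change FreeGroup.lift ![a, b] ((FreeGroup.of 1)⁻¹ * FreeGroup.of 0 * FreeGroup.of 1 *
        (FreeGroup.of 0 ^ (2 ^ (e + 1) - 1))⁻¹) = 1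
      simp only [map_mul, map_inv, map_pow, FreeGroup.lift_apply_of, cons_val_zero, cons_val_one]
      exact (mul_eq_pow_mul_iff_of_mul_self hb).1 hab
  exact ⟨PresentedGroup.toGroup hrel, PresentedGroup.toGroup.of hrel, PresentedGroup.toGroup.of hrel⟩

end QuasiDihedral

/-! ### Invariant subspaces and commuting involutions -/

section IrreducibleRepresentations

variable {ι : Type*} [Fintype ι] [DecidableEq ι]

theorem eq_bot_or_eq_top_of_isIrreducible {Γ : Type*} [Group Γ] {ρ : Γ →* GL ι ℚ}
    (hρ : (matrixRep ρ).IsIrreducible) (W : Submodule ℚ (ι → ℚ))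
    (hW : ∀ g, ∀ w ∈ W, (ρ g : Matrix ι ι ℚ) *ᵥ w ∈ W) : W = ⊥ ∨ W = ⊤ := by
  have := hρ
  let W' : Subrepresentation (matrixRep ρ) := ⟨W, fun g w hw => hW g w hw⟩
  rcases eq_bot_or_eq_top W' with h | h
  · exact Or.inl (congrArg Subrepresentation.toSubmodule h)
  · exact Or.inr (congrArg Subrepresentation.toSubmodule h)

theorem isIrreducible_of_forall_submodule [Nonempty ι] {Γ : Type*} [Group Γ] {ρ : Γ →* GL ι ℚ}
    (h : ∀ W : Submodule ℚ (ι → ℚ), (∀ g, ∀ w ∈ W, (ρ g : Matrix ι ι ℚ) *ᵥ w ∈ W) →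
      W = ⊥ ∨ W = ⊤) : (matrixRep ρ).IsIrreducible where
  exists_pair_ne := ⟨⊥, ⊤, fun hbt =>
    bot_ne_top (α := Submodule ℚ (ι → ℚ)) (congrArg Subrepresentation.toSubmodule hbt)⟩
  eq_bot_or_eq_top W := by
    rcases h W.toSubmodule fun g w hw => W.apply_mem_toSubmodule g hw with h | h
    · exact Or.inl (Subrepresentation.toSubmodule_injective h)
    · exact Or.inr (Subrepresentation.toSubmodule_injective h)

theorem isRationallyIrreducible_range [Nonempty ι] {Γ : Type*} [Group Γ] {ρ : Γ →* GL ι ℚ}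
    (hρ : (matrixRep ρ).IsIrreducible) : IsRationallyIrreducible ρ.range :=
  isIrreducible_of_forall_submodule fun W hW =>
    eq_bot_or_eq_top_of_isIrreducible hρ W fun g => hW ⟨ρ g, g, rfl⟩

/-- The fixed space of M is invariant. If it is zero, then w + M w = 0 for every w. -/
theorem eq_one_or_eq_neg_one_of_isIrreducible {Γ : Type*} [Group Γ] {ρ : Γ →* GL ι ℚ}
    (hρ : (matrixRep ρ).IsIrreducible) {M : Matrix ι ι ℚ} (hMM : M * M = 1)
    (hM : ∀ g, M * ρ g = ρ g * M) : M = 1 ∨ M = -1 := by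
  let W : Submodule ℚ (ι → ℚ) := LinearMap.eqLocus M.mulVecLin LinearMap.id
  have hmem : ∀ w, w ∈ W ↔ M *ᵥ w = w := fun w => Iff.rfl
  rcases eq_bot_or_eq_top_of_isIrreducible hρ W (fun g w hw => by
    rw [hmem] at hw ⊢
    rw [mulVec_mulVec, hM, ← mulVec_mulVec, hw]) with h | h
  · right
    refine Matrix.ext_of_mulVec_single fun i => ?_
    have h1 : Pi.single i 1 + M *ᵥ Pi.single i 1 ∈ W := by
      rw [hmem, mulVec_add, mulVec_mulVec, hMM, one_mulVec, add_comm]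
    rw [h, Submodule.mem_bot] at h1
    rw [neg_mulVec, one_mulVec]
    exact eq_neg_of_add_eq_zero_right h1
  · left
    refine Matrix.ext_of_mulVec_single fun i => ?_
    rw [one_mulVec, ← hmem, h]
    trivial

end IrreducibleRepresentations

/-! ### Classification of the irreducible representations of degree 2^(e+1) -/

section QuasiDihedralRepresentations

variable {e : ℕ} {L : Type*} [Field L] [Algebra ℚ L]
  {ζ : L} {ι : Type*} [Fintype ι] [DecidableEq ι] {σ : L ≃ₐ[ℚ] L}

/-- If a power of `X` is scalar, then the subspace generated by a common "eigenvector" is small. -/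
theorem exists_invariant_submodule {X Y : Matrix ι ι ℚ} {M u : ℕ} (hM : 0 < M) {c d : ℚ}
    (hX : X ^ M = c • (1 : Matrix ι ι ℚ)) (hYX : ∀ k, Y * X ^ k = X ^ (u * k) * Y)
    {v : ι → ℚ} (hv : Y *ᵥ v = d • v) :
    ∃ W : Submodule ℚ (ι → ℚ), v ∈ W ∧ Module.finrank ℚ W ≤ M ∧ (∀ w ∈ W, X *ᵥ w ∈ W) ∧
      ∀ w ∈ W, Y *ᵥ w ∈ W := by
  let W := Submodule.span ℚ (Set.range fun i : Fin M => X ^ (i : ℕ) *ᵥ v)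
  have hpow : ∀ k, X ^ k *ᵥ v ∈ W := by
    intro k
    rw [← Nat.mod_add_div k M, pow_add, pow_mul, hX, smul_pow, one_pow, mul_smul_comm, mul_one,
      smul_mulVec]
    exact W.smul_mem _ (Submodule.subset_span ⟨⟨k % M, Nat.mod_lt _ hM⟩, rfl⟩)
  have hspan : ∀ Z : Matrix ι ι ℚ, (∀ k, Z *ᵥ (X ^ k *ᵥ v) ∈ W) → ∀ w ∈ W, Z *ᵥ w ∈ W := by
    intro Z hZ w hw
    induction hw using Submodule.span_induction with
    | mem w hw => obtain ⟨i, rfl⟩ := hw; exact hZ i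
    | zero => rw [mulVec_zero]; exact zero_mem _
    | add a b _ _ ha hb => rw [mulVec_add]; exact add_mem ha hb
    | smul q a _ ha => rw [mulVec_smul]; exact W.smul_mem q ha
  refine ⟨W, by simpa using hpow 0, ?_, hspan X fun k => ?_, hspan Y fun k => ?_⟩
  · exact (finrank_range_le_card (R := ℚ) fun i : Fin M => X ^ (i : ℕ) *ᵥ v).trans_eq
      (Fintype.card_fin M)
  · rw [mulVec_mulVec, ← pow_succ']; exact hpow _
  · rw [mulVec_mulVec, hYX, ← mulVec_mulVec, hv, mulVec_smul]
    exact W.smul_mem d (hpow _)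

open QuasiDihedral

variable {ρ : QuasiDihedral (e + 3) →* GL ι ℚ}

theorem coe_map_y_mul_self (ρ : QuasiDihedral (e + 3) →* GL ι ℚ) :
    (ρ (y (e + 3)) : Matrix ι ι ℚ) * ρ (y (e + 3)) = 1 := by
  rw [← Units.val_mul, ← map_mul, y_mul_y, map_one, Units.val_one]

theorem coe_map_y_mul_x_pow (ρ : QuasiDihedral (e + 3) →* GL ι ℚ) (k : ℕ) :
    (ρ (y (e + 3)) : Matrix ι ι ℚ) * (ρ (x (e + 3)) : Matrix ι ι ℚ) ^ k =
      (ρ (x (e + 3)) : Matrix ι ι ℚ) ^ ((2 ^ (e + 1) - 1) * k) * ρ (y (e + 3)) := by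
  rw [← Units.val_pow_eq_pow_val, ← Units.val_pow_eq_pow_val, ← Units.val_mul, ← Units.val_mul,
    ← map_pow, ← map_pow, ← map_mul, ← map_mul, mul_pow_eq_pow_mul_of_mul_eq (y_mul_x e)]

theorem coe_map_eq_pow (ρ : QuasiDihedral (e + 3) →* GL ι ℚ) (g : QuasiDihedral (e + 3)) :
    ∃ k, (ρ g : Matrix ι ι ℚ) = (ρ (x (e + 3)) : Matrix ι ι ℚ) ^ k ∨
      (ρ g : Matrix ι ι ℚ) = (ρ (x (e + 3)) : Matrix ι ι ℚ) ^ k * ρ (y (e + 3)) := by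
  obtain ⟨k, rfl | rfl⟩ := exists_eq_pow g
  · exact ⟨k, Or.inl (by rw [map_pow, Units.val_pow_eq_pow_val])⟩
  · exact ⟨k, Or.inr (by rw [map_mul, map_pow, Units.val_mul, Units.val_pow_eq_pow_val])⟩

theorem pow_eq_one_or_of_isIrreducible (hρ : (matrixRep ρ).IsIrreducible) {k : ℕ}
    (h2k : (ρ (x (e + 3)) : Matrix ι ι ℚ) ^ (k + k) = 1) :
    (ρ (x (e + 3)) : Matrix ι ι ℚ) ^ k = 1 ∨ (ρ (x (e + 3)) : Matrix ι ι ℚ) ^ k = -1 := by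
  refine eq_one_or_eq_neg_one_of_isIrreducible hρ (by rw [← pow_add, h2k]) fun g => ?_
  have hX : ∀ l, (ρ (x (e + 3)) : Matrix ι ι ℚ) ^ k * (ρ (x (e + 3)) : Matrix ι ι ℚ) ^ l =
      (ρ (x (e + 3)) : Matrix ι ι ℚ) ^ l * (ρ (x (e + 3)) : Matrix ι ι ℚ) ^ k := fun l =>
    pow_mul_comm _ k l
  have hY : (ρ (y (e + 3)) : Matrix ι ι ℚ) * (ρ (x (e + 3)) : Matrix ι ι ℚ) ^ k =
      (ρ (x (e + 3)) : Matrix ι ι ℚ) ^ k * ρ (y (e + 3)) := by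
    rw [coe_map_y_mul_x_pow]
    congr 1
    -- Conjugation by Y raises X^k to an odd power, which is trivial on an element of square 1; so
    -- X^k commutes with the image.
    have hu : 2 ^ (e + 1) - 1 = 2 * (2 ^ e - 1) + 1 := by
      have := Nat.two_pow_pos e
      rw [pow_succ]; omega
    rw [hu, show (2 * (2 ^ e - 1) + 1) * k = (k + k) * (2 ^ e - 1) + k by ring, pow_add, pow_mul,
      h2k, one_pow, one_mul]
  obtain ⟨l, hl | hl⟩ := coe_map_eq_pow ρ g
  · rw [hl, hX]
  · rw [hl, ← mul_assoc, hX, mul_assoc, ← hY, ← mul_assoc]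

/-- The power is ±1. Were it 1, X^(2^e) would also be ±1, and an eigenvector of Y would generate an
invariant subspace of dimension at most 2^e, half of what is available. -/
theorem map_x_pow_eq_neg_one (hρ : (matrixRep ρ).IsIrreducible)
    (hcard : Fintype.card ι = 2 ^ (e + 1)) :
    (ρ (x (e + 3)) : Matrix ι ι ℚ) ^ 2 ^ (e + 1) = -1 := by
  have : Nonempty ι := Fintype.card_pos_iff.1 (by rw [hcard]; positivity)
  have hX : (ρ (x (e + 3)) : Matrix ι ι ℚ) ^ 2 ^ (e + 2) = 1 := by
    rw [← Units.val_pow_eq_pow_val, ← map_pow, x_pow, map_one, Units.val_one]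
  refine (pow_eq_one_or_of_isIrreducible hρ (by
    rw [← two_mul, ← pow_succ', hX])).resolve_left fun h1 => ?_
  obtain ⟨c, hc⟩ : ∃ c : ℚ, (ρ (x (e + 3)) : Matrix ι ι ℚ) ^ 2 ^ e = c • (1 : Matrix ι ι ℚ) := by
    rcases pow_eq_one_or_of_isIrreducible hρ (k := 2 ^ e) (by
      rw [← two_mul, ← pow_succ', h1]) with h | h
    · exact ⟨1, by rw [h, one_smul]⟩
    · exact ⟨-1, by rw [h, neg_smul, one_smul]⟩
  obtain ⟨v, d, hv, hvd⟩ : ∃ (v : ι → ℚ) (d : ℚ), v ≠ 0 ∧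
      (ρ (y (e + 3)) : Matrix ι ι ℚ) *ᵥ v = d • v := by
    by_cases hY : (ρ (y (e + 3)) : Matrix ι ι ℚ) = -1
    · obtain ⟨v, hv⟩ := exists_ne (0 : ι → ℚ)
      exact ⟨v, -1, hv, by rw [hY, neg_mulVec, one_mulVec, neg_smul, one_smul]⟩
    · obtain ⟨v, hv, hYv⟩ := exists_mulVec_eq_self (coe_map_y_mul_self ρ) hY
      exact ⟨v, 1, hv, by rw [hYv, one_smul]⟩
  obtain ⟨W, hvW, hdim, hWX, hWY⟩ := exists_invariant_submodule (by positivity) hc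
    (coe_map_y_mul_x_pow ρ) hvd
  have hWpow : ∀ k, ∀ w ∈ W, (ρ (x (e + 3)) : Matrix ι ι ℚ) ^ k *ᵥ w ∈ W := by
    intro k
    induction k with
    | zero => intro w hw; simpa using hw
    | succ k ih => intro w hw; rw [pow_succ, ← mulVec_mulVec]; exact ih _ (hWX w hw)
  rcases eq_bot_or_eq_top_of_isIrreducible hρ W (fun g w hw => by
    obtain ⟨k, hk | hk⟩ := coe_map_eq_pow ρ g
    · rw [hk]; exact hWpow k w hw
    · rw [hk, ← mulVec_mulVec]; exact hWpow k _ (hWY w hw)) with h | h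
  · rw [h, Submodule.mem_bot] at hvW
    exact hv hvW
  · rw [h, finrank_top, Module.finrank_fintype_fun_eq_card, hcard, pow_succ] at hdim
    have := Nat.two_pow_pos e
    omega

omit [Algebra ℚ L] in
theorem neg_inv_eq_pow (hζ : IsPrimitiveRoot ζ (2 ^ (e + 2))) :
    -ζ⁻¹ = ζ ^ (2 ^ (e + 1) - 1) := by
  have hζ0 : ζ ≠ 0 := hζ.ne_zero (by positivity)
  apply mul_right_cancel₀ hζ0
  rw [← pow_succ, Nat.sub_add_cancel Nat.one_le_two_pow, hζ.pow_two_pow_eq_neg_one, neg_mul,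
    inv_mul_cancel₀ hζ0]

theorem exists_model_of_isIrreducible [IsCyclotomicExtension {2 ^ (e + 2)} ℚ L]
    (hζ : IsPrimitiveRoot ζ (2 ^ (e + 2))) (he : 1 ≤ e) (hσ : σ ζ = -ζ⁻¹)
    (hρ : (matrixRep ρ).IsIrreducible) (hcard : Fintype.card ι = 2 ^ (e + 1)) :
    ∃ θ : L →ₐ[ℚ] Matrix ι ι ℚ, θ ζ = ρ (x (e + 3)) ∧
      (∀ a, (ρ (y (e + 3)) : Matrix ι ι ℚ) * θ a = θ (σ a) * ρ (y (e + 3))) ∧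
      ∃ v : ι → ℚ, v ≠ 0 ∧ (ρ (y (e + 3)) : Matrix ι ι ℚ) *ᵥ v = v := by
  have : Nonempty ι := Fintype.card_pos_iff.1 (by rw [hcard]; positivity)
  have hζ0 : ζ ≠ 0 := hζ.ne_zero (by positivity)
  obtain ⟨θ, hθ⟩ := hζ.exists_algHom (map_x_pow_eq_neg_one hρ hcard)
  have hY : (ρ (y (e + 3)) : Matrix ι ι ℚ) * θ ζ = θ (σ ζ) * ρ (y (e + 3)) := by
    have := coe_map_y_mul_x_pow ρ 1
    rw [pow_one, mul_one, ← hθ, ← map_pow, ← neg_inv_eq_pow hζ, ← hσ] at this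
    exact this
  refine ⟨θ, hθ, mul_algHom_eq_algHom_mul hζ θ σ hY,
    exists_mulVec_eq_self (coe_map_y_mul_self ρ) fun h => ?_⟩
  -- Y = -1 would centralize X, giving ζ = -ζ⁻¹, impossible for e ≥ 1. So Y has the eigenvalue 1.
  rw [h, neg_one_mul, mul_neg_one, neg_inj, hσ] at hY
  have h1 : ζ = -ζ⁻¹ := θ.injective hY
  apply hζ.sq_ne_neg_one he
  rw [pow_two]
  nth_rewrite 2 [h1]
  rw [mul_neg, mul_inv_cancel₀ hζ0]

theorem exists_isIrreducible [IsCyclotomicExtension {2 ^ (e + 2)} ℚ L]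
    (hζ : IsPrimitiveRoot ζ (2 ^ (e + 2))) (hσ : σ ζ = -ζ⁻¹)
    (hcard : Fintype.card ι = 2 ^ (e + 1)) :
    ∃ ρ : QuasiDihedral (e + 3) →* GL ι ℚ, (matrixRep ρ).IsIrreducible := by
  have : Nonempty ι := Fintype.card_pos_iff.1 (by rw [hcard]; positivity)
  have hζ0 : ζ ≠ 0 := hζ.ne_zero (by positivity)
  have hdim : Module.finrank ℚ L = Fintype.card ι := by
    rw [hcard, finrank_cyclotomic_two_pow (e := e)]
  have : FiniteDimensional ℚ L := IsCyclotomicExtension.finiteDimensional {2 ^ (e + 2)} ℚ L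
  let b : Module.Basis ι ℚ L := (Module.finBasisOfFinrankEq ℚ L hdim).reindex (Fintype.equivFin ι).symm
  let E : Module.End ℚ L ≃ₐ[ℚ] Matrix ι ι ℚ := algEquivMatrix b
  let θ : L →ₐ[ℚ] Matrix ι ι ℚ := (E : Module.End ℚ L →ₐ[ℚ] Matrix ι ι ℚ).comp (Algebra.lmul ℚ L)
  have hσσ : σ * σ = 1 := hζ.algEquiv_ext (by
    rw [AlgEquiv.mul_apply, hσ, map_neg, map_inv₀, hσ, inv_neg, inv_inv, neg_neg]; rfl)
  let s : Module.End ℚ L := σ.toLinearMap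
  have hYY : E s * E s = 1 := by
    rw [← map_mul, show s * s = 1 from LinearMap.ext fun a => DFunLike.congr_fun hσσ a, map_one]
  have hY : ∀ a, E s * θ a = θ (σ a) * E s := by
    intro a
    change E s * E (Algebra.lmul ℚ L a) = E (Algebra.lmul ℚ L (σ a)) * E s
    rw [← map_mul, ← map_mul]
    congr 1
    ext c
    simp [s]
  obtain ⟨X, hX⟩ : ∃ X : GL ι ℚ, (X : Matrix ι ι ℚ) = θ ζ := isUnit_algHom θ hζ0
  let Y : GL ι ℚ := ⟨E s, E s, hYY, hYY⟩
  obtain ⟨ρ, hρx, -⟩ := exists_hom (e := e) (a := X) (b := Y)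
    (Units.ext (by rw [Units.val_pow_eq_pow_val, hX, ← map_pow, hζ.pow_eq_one, map_one,
      Units.val_one]))
    (Units.ext hYY)
    (Units.ext (by
      rw [Units.val_mul, Units.val_mul, Units.val_pow_eq_pow_val, hX, ← map_pow,
        ← neg_inv_eq_pow hζ, ← hσ]
      exact hY ζ))
  refine ⟨ρ, isIrreducible_of_forall_submodule fun W hW => or_iff_not_imp_left.2 fun hbot => ?_⟩
  obtain ⟨v, hvW, hv⟩ := Submodule.exists_mem_ne_zero_of_ne_bot hbot
  have hWθ : ∀ a, ∀ w ∈ W, θ a *ᵥ w ∈ W := by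
    intro a
    induction a using hζ.cyclotomic_induction with
    | alg q =>
      intro w hw
      rw [AlgHom.commutes, Algebra.algebraMap_eq_smul_one, smul_mulVec, one_mulVec]
      exact W.smul_mem q hw
    | gen => intro w hw; rw [← hX, ← hρx]; exact hW _ w hw
    | add a c ha hc => intro w hw; rw [map_add, add_mulVec]; exact add_mem (ha w hw) (hc w hw)
    | mul a c ha hc => intro w hw; rw [map_mul, ← mulVec_mulVec]; exact ha _ (hc w hw)
  rw [eq_top_iff]
  intro w _
  obtain ⟨a, rfl⟩ := (algHom_mulVec_bijective θ hdim hv).2 w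
  exact hWθ a v hvW

/-- Since Y v = v, the map a ↦ θ(a) v carries (ζ·, σ) on L to (X, Y). Both representations are thus
isomorphic to the same model, and T is the comparison of the two identifications. -/
theorem exists_conj_of_isIrreducible [IsCyclotomicExtension {2 ^ (e + 2)} ℚ L]
    (hζ : IsPrimitiveRoot ζ (2 ^ (e + 2))) (he : 1 ≤ e) (hσ : σ ζ = -ζ⁻¹)
    (hcard : Fintype.card ι = 2 ^ (e + 1)) {ρ₁ ρ₂ : QuasiDihedral (e + 3) →* GL ι ℚ}
    (hρ₁ : (matrixRep ρ₁).IsIrreducible) (hρ₂ : (matrixRep ρ₂).IsIrreducible) :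
    ∃ T : GL ι ℚ, ∀ g, ρ₂ g = T * ρ₁ g * T⁻¹ := by
  have hdim : Module.finrank ℚ L = Fintype.card ι := by
    rw [hcard, finrank_cyclotomic_two_pow (e := e)]
  obtain ⟨θ₁, hx₁, hy₁, v₁, hv₁, hYv₁⟩ := exists_model_of_isIrreducible hζ he hσ hρ₁ hcard
  obtain ⟨θ₂, hx₂, hy₂, v₂, hv₂, hYv₂⟩ := exists_model_of_isIrreducible hζ he hσ hρ₂ hcard
  let φ₁ := algHomMulVecEquiv θ₁ hdim hv₁
  let φ₂ := algHomMulVecEquiv θ₂ hdim hv₂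
  let t : (ι → ℚ) ≃ₗ[ℚ] (ι → ℚ) := φ₁.symm.trans φ₂
  have ht : ∀ a, LinearMap.toMatrix' t.toLinearMap *ᵥ (θ₁ a *ᵥ v₁) = θ₂ a *ᵥ v₂ := by
    intro a
    rw [← algHomMulVecEquiv_apply θ₁ hdim hv₁, LinearMap.toMatrix'_mulVec]
    change φ₂ (φ₁.symm (φ₁ a)) = _
    rw [LinearEquiv.symm_apply_apply]
    rfl
  have hconj : ∀ M₁ M₂ : Matrix ι ι ℚ, (∀ a, ∃ a', M₁ *ᵥ (θ₁ a *ᵥ v₁) = θ₁ a' *ᵥ v₁ ∧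
      M₂ *ᵥ (θ₂ a *ᵥ v₂) = θ₂ a' *ᵥ v₂) →
      M₂ * LinearMap.toMatrix' t.toLinearMap = LinearMap.toMatrix' t.toLinearMap * M₁ := by
    intro M₁ M₂ h
    refine Matrix.ext_of_mulVec_single fun i => ?_
    obtain ⟨a, ha⟩ := (algHom_mulVec_bijective θ₁ hdim hv₁).2 (Pi.single i 1)
    obtain ⟨a', h₁, h₂⟩ := h a
    change θ₁ a *ᵥ v₁ = _ at ha
    rw [← ha, ← mulVec_mulVec, ht, h₂, ← mulVec_mulVec, h₁, ht]
  let T : GL ι ℚ := ⟨LinearMap.toMatrix' t.toLinearMap, LinearMap.toMatrix' t.symm.toLinearMap,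
    by
      rw [← LinearMap.toMatrix'_comp, show t.toLinearMap ∘ₗ t.symm.toLinearMap = LinearMap.id from
        LinearMap.ext t.apply_symm_apply, LinearMap.toMatrix'_id],
    by
      rw [← LinearMap.toMatrix'_comp, show t.symm.toLinearMap ∘ₗ t.toLinearMap = LinearMap.id from
        LinearMap.ext t.symm_apply_apply, LinearMap.toMatrix'_id]⟩
  have hT : (MulAut.conj T).toMonoidHom.comp ρ₁ = ρ₂ := by
    have key : ∀ g, (ρ₂ g : Matrix ι ι ℚ) * T = T * ρ₁ g →
        (MulAut.conj T).toMonoidHom.comp ρ₁ g = ρ₂ g := by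
      intro g h
      change T * ρ₁ g * T⁻¹ = ρ₂ g
      rw [mul_inv_eq_iff_eq_mul]
      exact Units.ext h.symm
    refine hom_ext (key _ (hconj _ _ fun a => ⟨ζ * a, ?_, ?_⟩))
      (key _ (hconj _ _ fun a => ⟨σ a, ?_, ?_⟩))
    · rw [mulVec_mulVec, map_mul, hx₁]
    · rw [mulVec_mulVec, map_mul, hx₂]
    · rw [mulVec_mulVec, hy₁, ← mulVec_mulVec, hYv₁]
    · rw [mulVec_mulVec, hy₂, ← mulVec_mulVec, hYv₂]
  exact ⟨T, fun g => by rw [← hT]; rfl⟩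

end QuasiDihedralRepresentations

/-! ### Conjugation into the standard symplectic group -/

section Conjugation

variable {ι : Type*} [Fintype ι] [DecidableEq ι]

theorem mem_conjSubgroup_iff {T g : GL ι ℚ} {G : Subgroup (GL ι ℚ)} :
    g ∈ conjSubgroup T G ↔ T⁻¹ * g * T ∈ G := by
  constructor
  · rintro ⟨h, hh, rfl⟩
    change T⁻¹ * (T * h * T⁻¹) * T ∈ G
    rwa [show T⁻¹ * (T * h * T⁻¹) * T = h by group]
  · intro h
    refine ⟨_, h, ?_⟩
    change T * (T⁻¹ * g * T) * T⁻¹ = g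
    group

instance finite_conjSubgroup (T : GL ι ℚ) (G : Subgroup (GL ι ℚ)) [Finite G] :
    Finite (conjSubgroup T G) :=
  Set.Finite.image (MulAut.conj T).toMonoidHom (Set.toFinite (G : Set (GL ι ℚ)))

theorem conj_mul_form_mul_transpose {T g : GL ι ℚ} {F F' : Matrix ι ι ℚ}
    (hT : (T : Matrix ι ι ℚ) * F * (T : Matrix ι ι ℚ)ᵀ = F') :
    (g : Matrix ι ι ℚ) * F * (g : Matrix ι ι ℚ)ᵀ = F ↔
      ((T * g * T⁻¹ : GL ι ℚ) : Matrix ι ι ℚ) * F' *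
        ((T * g * T⁻¹ : GL ι ℚ) : Matrix ι ι ℚ)ᵀ = F' := by
  have h1 : ((T * g * T⁻¹ : GL ι ℚ) : Matrix ι ι ℚ) * (T : Matrix ι ι ℚ) = T * g := by
    rw [← Units.val_mul, ← Units.val_mul, inv_mul_cancel_right]
  have h2 : ((T * g * T⁻¹ : GL ι ℚ) : Matrix ι ι ℚ) * F' *
      ((T * g * T⁻¹ : GL ι ℚ) : Matrix ι ι ℚ)ᵀ =
      T * ((g : Matrix ι ι ℚ) * F * (g : Matrix ι ι ℚ)ᵀ) * (T : Matrix ι ι ℚ)ᵀ := by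
    calc _ = (((T * g * T⁻¹ : GL ι ℚ) : Matrix ι ι ℚ) * (T : Matrix ι ι ℚ)) * F *
          (((T * g * T⁻¹ : GL ι ℚ) : Matrix ι ι ℚ) * (T : Matrix ι ι ℚ))ᵀ := by
          rw [← hT, transpose_mul]; simp only [Matrix.mul_assoc]
      _ = _ := by rw [h1, transpose_mul]; simp only [Matrix.mul_assoc]
  rw [h2]
  constructor
  · intro h; rw [h, hT]
  · intro h
    rw [← hT] at h
    have hTT : IsUnit (T : Matrix ι ι ℚ)ᵀ := (Matrix.isUnit_transpose _).2 T.isUnit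
    exact T.isUnit.mul_left_cancel (hTT.mul_right_cancel h)

theorem mem_Sp_iff {k : ℕ} {g : GL (Fin k ⊕ Fin k) ℚ} :
    g ∈ Sp k ↔ (g : Matrix (Fin k ⊕ Fin k) (Fin k ⊕ Fin k) ℚ) * Matrix.J (Fin k) ℚ *
      (g : Matrix (Fin k ⊕ Fin k) (Fin k ⊕ Fin k) ℚ)ᵀ = Matrix.J (Fin k) ℚ :=
  SymplecticGroup.mem_iff

theorem exists_conjSubgroup_le_Sp {k : ℕ} {G : Subgroup (GL (Fin k ⊕ Fin k) ℚ)}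
    (hG : IsSymplectic G) : ∃ T, conjSubgroup T G ≤ Sp k := by
  obtain ⟨F, hFT, hF, hGF⟩ := hG
  obtain ⟨T, hT⟩ := exists_congruent_J hFT hF
  refine ⟨T, ?_⟩
  rintro _ ⟨g, hg, rfl⟩
  exact mem_Sp_iff.2 ((conj_mul_form_mul_transpose hT).1 (hGF g hg))

theorem isSymplectic_conjSubgroup_of_le_Sp {k : ℕ} {H : Subgroup (GL (Fin k ⊕ Fin k) ℚ)}
    (hH : H ≤ Sp k) (T : GL (Fin k ⊕ Fin k) ℚ) : IsSymplectic (conjSubgroup T H) := by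
  refine ⟨T * Matrix.J (Fin k) ℚ * (T : Matrix (Fin k ⊕ Fin k) (Fin k ⊕ Fin k) ℚ)ᵀ, ?_, ?_, ?_⟩
  · simp [transpose_mul, Matrix.mul_assoc]
  · exact (T.isUnit.mul ((Matrix.isUnit_iff_isUnit_det _).2 (Matrix.isUnit_det_J _ _))).mul
      ((Matrix.isUnit_transpose _).2 T.isUnit)
  · rintro _ ⟨g, hg, rfl⟩
    exact (conj_mul_form_mul_transpose rfl).1 (mem_Sp_iff.1 (hH hg))

/-- A finite overgroup inside `Sp` pulls back along T to a finite overgroup of G preserving some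
skew form, though not a prescribed one; maximality over all forms is what is needed. -/
theorem maximal_conjSubgroup_of_maximal {k : ℕ} {G : Subgroup (GL (Fin k ⊕ Fin k) ℚ)}
    (hG : Maximal (fun H : Subgroup (GL (Fin k ⊕ Fin k) ℚ) => Finite H ∧ IsSymplectic H) G)
    {T : GL (Fin k ⊕ Fin k) ℚ} (hT : conjSubgroup T G ≤ Sp k) :
    Maximal (fun H : Subgroup (GL (Fin k ⊕ Fin k) ℚ) => Finite H ∧ H ≤ Sp k)
      (conjSubgroup T G) := by
  have := hG.1.1
  refine ⟨⟨finite_conjSubgroup T G, hT⟩, ?_⟩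
  rintro H ⟨hfin, hH⟩ hle g hg
  have hle' : G ≤ conjSubgroup T⁻¹ H := fun h hh => mem_conjSubgroup_iff.2
    (hle (mem_conjSubgroup_iff.2 (by
      rwa [show T⁻¹ * (T⁻¹⁻¹ * h * T⁻¹) * T = h by group])))
  have := hG.2 ⟨finite_conjSubgroup T⁻¹ H, isSymplectic_conjSubgroup_of_le_Sp hH T⁻¹⟩ hle'
  refine mem_conjSubgroup_iff.2 (this (mem_conjSubgroup_iff.2 ?_))
  rwa [show T⁻¹⁻¹ * (T⁻¹ * g * T) * T⁻¹ = g by group]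

end Conjugation

/-! ### Faithfulness, invariant form and commuting algebra of the image -/

section QuasiDihedralImage

open QuasiDihedral

variable {e : ℕ} {L : Type*} [Field L] [Algebra ℚ L]
  {ζ : L} {ι : Type*} [Fintype ι] [DecidableEq ι] {σ : L ≃ₐ[ℚ] L}
  {ρ : QuasiDihedral (e + 3) →* GL ι ℚ} {θ : L →ₐ[ℚ] Matrix ι ι ℚ}

theorem coe_map_eq_algHom_pow (hθ : θ ζ = ρ (x (e + 3))) (g : QuasiDihedral (e + 3)) :
    ∃ k, (g = x (e + 3) ^ k ∧ (ρ g : Matrix ι ι ℚ) = θ (ζ ^ k)) ∨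
      (g = x (e + 3) ^ k * y (e + 3) ∧
        (ρ g : Matrix ι ι ℚ) = θ (ζ ^ k) * ρ (y (e + 3))) := by
  obtain ⟨k, rfl | rfl⟩ := exists_eq_pow g
  · exact ⟨k, Or.inl ⟨rfl, by rw [map_pow, map_pow, Units.val_pow_eq_pow_val, hθ]⟩⟩
  · exact ⟨k, Or.inr ⟨rfl, by
      rw [map_mul, map_pow, map_pow, Units.val_mul, Units.val_pow_eq_pow_val, hθ]⟩⟩

theorem mem_range_iff_algHom_pow (hθ : θ ζ = ρ (x (e + 3))) (g : GL ι ℚ) :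
    g ∈ ρ.range ↔ ∃ k, (g : Matrix ι ι ℚ) = θ (ζ ^ k) ∨
      (g : Matrix ι ι ℚ) = θ (ζ ^ k) * ρ (y (e + 3)) := by
  constructor
  · rintro ⟨g, rfl⟩
    obtain ⟨k, ⟨-, h⟩ | ⟨-, h⟩⟩ := coe_map_eq_algHom_pow hθ g
    · exact ⟨k, Or.inl h⟩
    · exact ⟨k, Or.inr h⟩
  · rintro ⟨k, h | h⟩
    · exact ⟨x (e + 3) ^ k, Units.ext (by
        rw [h, map_pow, map_pow, Units.val_pow_eq_pow_val, hθ])⟩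
    · exact ⟨x (e + 3) ^ k * y (e + 3), Units.ext (by
        rw [h, map_mul, map_pow, map_pow, Units.val_mul, Units.val_pow_eq_pow_val, hθ])⟩

theorem injective_of_algHom [Nonempty ι] (hζ : IsPrimitiveRoot ζ (2 ^ (e + 2))) (he : 1 ≤ e)
    (hσ : σ ζ = -ζ⁻¹) (hθ : θ ζ = ρ (x (e + 3)))
    (hY : ∀ a, (ρ (y (e + 3)) : Matrix ι ι ℚ) * θ a = θ (σ a) * ρ (y (e + 3))) :
    Function.Injective ρ := by
  have hζ0 : ζ ≠ 0 := hζ.ne_zero (by positivity)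
  rw [injective_iff_map_eq_one]
  intro g hg
  obtain ⟨k, ⟨rfl, h⟩ | ⟨-, h⟩⟩ := coe_map_eq_algHom_pow hθ g
  · rw [hg, Units.val_one, ← map_one θ] at h
    obtain ⟨l, rfl⟩ := (hζ.pow_eq_one_iff_dvd k).1 (θ.injective h).symm
    rw [pow_mul, x_pow, one_pow]
  · exfalso
    rw [hg, Units.val_one] at h
    have h1 : (ρ (y (e + 3)) : Matrix ι ι ℚ) * θ (ζ ^ k) = 1 := mul_eq_one_comm.1 h.symm
    have h2 : θ (σ ζ) * ρ (y (e + 3)) = θ ζ * ρ (y (e + 3)) := by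
      rw [← hY]
      apply (isUnit_algHom θ (pow_ne_zero k hζ0)).mul_right_cancel
      calc (ρ (y (e + 3)) : Matrix ι ι ℚ) * θ ζ * θ (ζ ^ k)
          = ρ (y (e + 3)) * θ (ζ ^ k) * θ ζ := by
            rw [mul_assoc, ← map_mul, mul_comm ζ, map_mul, ← mul_assoc]
        _ = θ ζ * (ρ (y (e + 3)) * θ (ζ ^ k)) := by rw [h1, one_mul, mul_one]
        _ = θ ζ * ρ (y (e + 3)) * θ (ζ ^ k) := (mul_assoc _ _ _).symm
    have h3 : σ ζ = ζ := θ.injective ((ρ (y (e + 3))).isUnit.mul_right_cancel h2)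
    apply hζ.sq_ne_neg_one he
    rw [pow_two]
    nth_rewrite 1 [← h3]
    rw [hσ, neg_mul, inv_mul_cancel₀ hζ0]

theorem isSymplectic_range_of_algHom [Nonempty ι] (hζ : IsPrimitiveRoot ζ (2 ^ (e + 2)))
    (hσ : σ ζ = -ζ⁻¹) (hθ : θ ζ = ρ (x (e + 3)))
    (hY : ∀ a, (ρ (y (e + 3)) : Matrix ι ι ℚ) * θ a = θ (σ a) * ρ (y (e + 3))) :
    IsSymplectic ρ.range := by
  have hζ0 : ζ ≠ 0 := hζ.ne_zero (by positivity)
  have : Finite ρ.range := Set.finite_range ρ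
  obtain ⟨S, hSu, hST, hS⟩ := exists_invariant_symmetric_form ρ.range
  have hxinv : ((ρ (x (e + 3)))⁻¹ : GL ι ℚ) = θ ζ⁻¹ := by
    rw [← Matrix.mul_one (((ρ (x (e + 3)))⁻¹ : GL ι ℚ) : Matrix ι ι ℚ), ← map_one θ,
      ← mul_inv_cancel₀ hζ0, map_mul, ← Matrix.mul_assoc, hθ, GL_coe_inv_mul, Matrix.one_mul]
  have hSx : S * (θ ζ)ᵀ = θ ζ⁻¹ * S := by
    rw [← hxinv, hθ]
    exact mul_transpose_eq_inv_mul (hS _ ⟨_, rfl⟩)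
  have hSx' : S * (θ ζ⁻¹)ᵀ = θ ζ * S := by
    have h := mul_transpose_eq_inv_mul (hS _ (inv_mem ⟨x (e + 3), rfl⟩))
    rwa [inv_inv, hxinv, ← hθ] at h
  have hπ : ζ - ζ⁻¹ ≠ 0 := by
    intro h0
    have h1 : ζ ^ 2 = 1 := by
      rw [pow_two]; nth_rewrite 1 [sub_eq_zero.1 h0]; rw [inv_mul_cancel₀ hζ0]
    have := Nat.le_of_dvd two_pos ((hζ.pow_eq_one_iff_dvd 2).1 h1)
    have : 2 ^ 2 ≤ 2 ^ (e + 2) := Nat.pow_le_pow_right two_pos (by omega)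
    omega
  have hfix : σ (ζ - ζ⁻¹) = ζ - ζ⁻¹ := by
    rw [map_sub, map_inv₀, hσ, inv_neg, inv_inv]; ring
  -- The S-adjoint of π is -π, which gives skewness; σ fixes π, which gives invariance under Y.
  refine ⟨θ (ζ - ζ⁻¹) * S, ?_, (isUnit_algHom θ hπ).mul hSu, fun g hg => ?_⟩
  · rw [transpose_mul, hST, map_sub, transpose_sub, mul_sub, hSx, hSx', sub_mul, neg_sub]
  · have hcomm : (g : Matrix ι ι ℚ) * θ (ζ - ζ⁻¹) = θ (ζ - ζ⁻¹) * g := by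
      obtain ⟨k, h | h⟩ := (mem_range_iff_algHom_pow hθ g).1 hg
      · rw [h, ← map_mul, ← map_mul, mul_comm]
      · rw [h, mul_assoc, hY, hfix, ← mul_assoc, ← mul_assoc, ← map_mul, ← map_mul, mul_comm]
    rw [← mul_assoc, hcomm, mul_assoc, mul_assoc, ← mul_assoc (g : Matrix ι ι ℚ) S, hS g hg]

/-- Commuting with X leaves L, and commuting with Y cuts it down to the fixed field of σ. -/
theorem nonempty_commutingAlgebra_algEquiv [IsCyclotomicExtension {2 ^ (e + 2)} ℚ L]
    (hζ : IsPrimitiveRoot ζ (2 ^ (e + 2)))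
    (hσ : σ ζ = -ζ⁻¹) (hθ : θ ζ = ρ (x (e + 3))) (hdim : Module.finrank ℚ L = Fintype.card ι)
    (hY : ∀ a, (ρ (y (e + 3)) : Matrix ι ι ℚ) * θ a = θ (σ a) * ρ (y (e + 3)))
    {v : ι → ℚ} (hv : v ≠ 0) (hYv : (ρ (y (e + 3)) : Matrix ι ι ℚ) *ᵥ v = v) :
    Nonempty (commutingAlgebra ρ.range ≃ₐ[ℚ] IntermediateField.adjoin ℚ {ζ - ζ⁻¹}) := by
  have : Nonempty ι := by
    obtain ⟨i, -⟩ := Function.ne_iff.1 hv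
    exact ⟨i⟩
  have hmem : ∀ c, c ∈ IntermediateField.adjoin ℚ {ζ - ζ⁻¹} →
      θ c ∈ commutingAlgebra ρ.range := by
    intro c hc
    rw [hζ.mem_adjoin_sub_inv_iff hσ] at hc
    rw [commutingAlgebra, Subalgebra.mem_centralizer_iff]
    rintro _ ⟨g, hg, rfl⟩
    obtain ⟨k, h | h⟩ := (mem_range_iff_algHom_pow hθ g).1 hg
    · simp only [h]; rw [← map_mul, ← map_mul, mul_comm]
    · simp only [h]; rw [mul_assoc, hY, hc, ← mul_assoc, ← mul_assoc, ← map_mul, ← map_mul, mul_comm]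
  let f : IntermediateField.adjoin ℚ {ζ - ζ⁻¹} →+* commutingAlgebra ρ.range :=
    ((θ : L →+* Matrix ι ι ℚ).comp
      (algebraMap (IntermediateField.adjoin ℚ {ζ - ζ⁻¹}) L)).codRestrict _ fun c => hmem c c.2
  refine ⟨(AlgEquiv.ofBijective f.toRatAlgHom ⟨fun a b h => ?_, ?_⟩).symm⟩
  · have h' : θ a = θ b := congrArg Subtype.val h
    exact Subtype.ext (θ.injective h')
  · rintro ⟨M, hM⟩
    rw [commutingAlgebra, Subalgebra.mem_centralizer_iff] at hM
    have hMx : M * θ ζ = θ (AlgEquiv.refl (R := ℚ) ζ) * M := by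
      rw [AlgEquiv.coe_refl, id, hθ]
      exact (hM _ ⟨ρ (x (e + 3)), ⟨_, rfl⟩, rfl⟩).symm
    obtain ⟨c, rfl, hc⟩ := exists_fixed_algHom_eq_of_commute θ hdim hY hv hYv
      (mul_algHom_eq_algHom_mul hζ θ AlgEquiv.refl hMx)
      (hM _ ⟨ρ (y (e + 3)), ⟨_, rfl⟩, rfl⟩).symm
    exact ⟨⟨c, (hζ.mem_adjoin_sub_inv_iff hσ).2 hc⟩, rfl⟩

end QuasiDihedralImage

/-- Matrices of size `2^(n-2)` are indexed by two blocks of size `2^(n-3)`. -/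
theorem mainTheorem6 (n : ℕ) (hn : 5 ≤ n) :
    -- existence and uniqueness of the irreducible rational representation of degree `2^(n-2)`
    (∃ ρ : QuasiDihedral n →* GL (Fin (2 ^ (n - 3)) ⊕ Fin (2 ^ (n - 3))) ℚ,
      (matrixRep ρ).IsIrreducible) ∧
    (∀ ρ₁ ρ₂ : QuasiDihedral n →* GL (Fin (2 ^ (n - 3)) ⊕ Fin (2 ^ (n - 3))) ℚ,
      (matrixRep ρ₁).IsIrreducible → (matrixRep ρ₂).IsIrreducible →
        ∃ T : GL (Fin (2 ^ (n - 3)) ⊕ Fin (2 ^ (n - 3))) ℚ, ∀ g, ρ₂ g = T * ρ₁ g * T⁻¹) ∧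
    (∀ ρ : QuasiDihedral n →* GL (Fin (2 ^ (n - 3)) ⊕ Fin (2 ^ (n - 3))) ℚ,
      (matrixRep ρ).IsIrreducible →
        Function.Injective ρ ∧
        IsSIMF ρ.range ∧
        -- the image is conjugate into the standard symplectic group, and each such conjugate
        -- is maximal among its finite subgroups
        (∃ T, conjSubgroup T ρ.range ≤ Sp (2 ^ (n - 3))) ∧
        (∀ T, conjSubgroup T ρ.range ≤ Sp (2 ^ (n - 3)) →
          Maximal (fun H : Subgroup (GL (Fin (2 ^ (n - 3)) ⊕ Fin (2 ^ (n - 3))) ℚ) =>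
            Finite H ∧ H ≤ Sp (2 ^ (n - 3))) (conjSubgroup T ρ.range)) ∧
        (∀ ζ : CyclotomicField (2 ^ (n - 1)) ℚ, IsPrimitiveRoot ζ (2 ^ (n - 1)) →
          Nonempty (commutingAlgebra ρ.range ≃ₐ[ℚ]
            IntermediateField.adjoin ℚ ({ζ - ζ⁻¹} : Set (CyclotomicField (2 ^ (n - 1)) ℚ))))) := by
  obtain ⟨e, rfl⟩ : ∃ e, n = e + 3 := ⟨n - 3, by omega⟩
  have he : 2 ≤ e := by omega
  have hcard : Fintype.card (Fin (2 ^ e) ⊕ Fin (2 ^ e)) = 2 ^ (e + 1) := by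
    rw [Fintype.card_sum, Fintype.card_fin, pow_succ, mul_two]
  have : Nonempty (Fin (2 ^ e) ⊕ Fin (2 ^ e)) :=
    Fintype.card_pos_iff.1 (by rw [hcard]; positivity)
  have : IsCyclotomicExtension {2 ^ (e + 2)} ℚ (CyclotomicField (2 ^ (e + 2)) ℚ) := by
    have : NeZero ((2 ^ (e + 2) : ℕ) : ℚ) := ⟨by positivity⟩
    exact CyclotomicField.isCyclotomicExtension (2 ^ (e + 2)) ℚ
  have hdim : Module.finrank ℚ (CyclotomicField (2 ^ (e + 2)) ℚ) =
      Fintype.card (Fin (2 ^ e) ⊕ Fin (2 ^ e)) := by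
    rw [hcard, finrank_cyclotomic_two_pow (e := e)]
  have hζ := IsCyclotomicExtension.zeta_spec (2 ^ (e + 2)) ℚ (CyclotomicField (2 ^ (e + 2)) ℚ)
  obtain ⟨σ, hσ⟩ := hζ.exists_algEquiv_neg_inv
  refine ⟨exists_isIrreducible hζ hσ hcard, fun ρ₁ ρ₂ h₁ h₂ =>
    exists_conj_of_isIrreducible hζ (by omega) hσ hcard h₁ h₂, fun ρ hρ => ?_⟩
  obtain ⟨θ, hθ, hY, v, hv, hYv⟩ := exists_model_of_isIrreducible hζ (by omega) hσ hρ hcard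
  have hsymp := isSymplectic_range_of_algHom hζ hσ hθ hY
  have hmax : Maximal (fun H : Subgroup (GL (Fin (2 ^ e) ⊕ Fin (2 ^ e)) ℚ) =>
      Finite H ∧ IsSymplectic H) ρ.range := by
    refine ⟨⟨Set.finite_range ρ, hsymp⟩, ?_⟩
    rintro H ⟨hfin, hH⟩ hle
    exact le_of_isSymplectic_of_le hζ he hσ θ hdim (coe_map_y_mul_self ρ) hY hv hYv
      (mem_range_iff_algHom_pow hθ) hfin hH hle
  refine ⟨injective_of_algHom hζ (by omega) hσ hθ hY, ⟨isRationallyIrreducible_range hρ, hmax⟩,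
    exists_conjSubgroup_le_Sp hsymp, fun T hT => maximal_conjSubgroup_of_maximal hmax hT, ?_⟩
  -- The model is rebuilt with ξ in place of the chosen root, so no comparison of the two fields is
  -- needed.
  intro (ξ : CyclotomicField (2 ^ (e + 2)) ℚ) (hξ : IsPrimitiveRoot ξ (2 ^ (e + 2)))
  obtain ⟨τ, hτ⟩ := hξ.exists_algEquiv_neg_inv
  obtain ⟨η, hη, hYη, w, hw, hYw⟩ := exists_model_of_isIrreducible hξ (by omega) hτ hρ hcard
  have key := nonempty_commutingAlgebra_algEquiv hξ hτ hη hdim hYη hw hYw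
  exact key
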